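/- Work in the Euclidean plane $\mathbb{E}^2$ with origin $o$. A convex domain is a compact convex set $K\subseteq\mathbb{E}^2$ with nonempty interior; it is $o$-symmetric if $K=-K$, smooth if at every point of its boundary $\mathrm{bd}\,K$ it is supported by a unique line, and strictly convex if $\mathrm{bd}\,K$ contains no nontrivial line segment. For an $o$-symmetric convex domain $K$ with norm $\|x\|_K=\inf\{\lambda>0: x\in\lambda K\}$, a nonzero vector $x$ is Birkhoff orthogonal to a nonzero vector $y$, written $x\dashv_K y$, if $\|x\|_K\le\|x+ty\|_K$ for all $t\in\mathbb{R}$. An $A$-domain is an $o$-symmetric convex domain $\mathbf{A}$ for which there are a circular disk $\mathbf{B}$ centered at $o$ and non-overlapping nontrivial arcs $c,-c,c',-c'$ on $\mathrm{bd}\,\mathbf{B}\cap\mathrm{bd}\,\mathbf{A}$ such that for every $x\in c$ there is $x'\in c'$ with $x\dashv_{\mathbf{B}}x'$, and for every $x'\in c'$ there is $x\in c$ with $x'\dashv_{\mathbf{B}}x$. **Theorem.** The images of smooth strictly convex $A$-domains under invertible affine maps that are $o$-symmetric form a dense subset, with respect to the Hausdorff distance, of the space of smooth $o$-symmetric strictly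 convex domains. Moreover, for every smooth $o$-symmetric strictly convex domain $K_o$ and all $\varepsilon,\delta>0$ there is a smooth $o$-symmetric strictly convex domain $\mathbf{A}'$ that is the image of a smooth strictly convex $A$-domain under an invertible affine map, has Hausdorff distance less than $\varepsilon$ from $K_o$, and satisfies $$\mathrm{length}(\mathrm{bd}\,K_o)<\mathrm{length}(\mathrm{bd}\,\mathbf{A}'\cap\mathrm{bd}\,K_o)+\delta .$$ Here length is one-dimensional Hausdorff measure. -/

import Mathlib

open scoped Pointwise MeasureTheory
open TopologicalSpace (NonemptyCompacts)

/-- The Euclidean plane. -/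
abbrev Plane : Type := EuclideanSpace ℝ (Fin 2)

/-- A convex domain: a compact convex subset of the plane with nonempty interior. -/
structure IsConvexDomain (K : Set Plane) : Prop where
  isCompact : IsCompact K
  convex : Convex ℝ K
  interior_nonempty : (interior K).Nonempty

/-- `K` is symmetric about the origin. -/
def IsOSymmetric (K : Set Plane) : Prop := -K = K

/-- `L` is a line supporting `K` at the point `p` of `K`: `L` passes through `p` and has a normal
vector `u ≠ 0` such that `K` lies in the closed half-plane bounded by `L` with outer normal `u`. -/
def IsSupportingLine (K : Set Plane) (p : Plane) (L : Set Plane) : Prop :=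
  p ∈ K ∧ ∃ u : Plane, u ≠ 0 ∧ L = {z | inner ℝ u z = inner ℝ u p} ∧
    ∀ z ∈ K, inner ℝ u z ≤ inner ℝ u p

/-- `K` is smooth: at every boundary point it is supported by a unique line. -/
def IsSmoothDomain (K : Set Plane) : Prop :=
  ∀ p ∈ frontier K, ∃! L : Set Plane, IsSupportingLine K p L

/-- Birkhoff orthogonality of nonzero vectors with respect to the norm with unit ball `K`,
that is, with respect to the Minkowski functional `gauge K`. -/
def BirkhoffOrthogonal (K : Set Plane) (x y : Plane) : Prop :=
  x ≠ 0 ∧ y ≠ 0 ∧ ∀ t : ℝ, gauge K x ≤ gauge K (x + t • y)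

/-- The point with polar angle `t` on the circle of radius `r` about the origin. -/
noncomputable def circlePoint (r t : ℝ) : Plane := !₂[r * Real.cos t, r * Real.sin t]

/-- The closed arc between the polar angles `a` and `b` on the circle of radius `r`. -/
noncomputable def closedArc (r a b : ℝ) : Set Plane := circlePoint r '' Set.Icc a b

/-- The open arc between the polar angles `a` and `b`, i.e. (for `b - a < 2 * π`) the closed arc
without its two end points. -/
noncomputable def openArc (r a b : ℝ) : Set Plane := circlePoint r '' Set.Ioo a b

/-- `A` is an Auerbach domain: an origin-symmetric convex domain for which there are a disk `B` of
radius `r > 0` centred at the origin and nontrivial arcs `c = closedArc r a b` and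
`c' = closedArc r a' b'` such that `c, -c, c', -c'` lie on `bd B ∩ bd A`, do not overlap (the
corresponding open arcs are pairwise disjoint), every point of `c` is Birkhoff orthogonal in the
norm of `B` to some point of `c'`, and every point of `c'` to some point of `c`. -/
def IsADomain (A : Set Plane) : Prop :=
  IsConvexDomain A ∧ IsOSymmetric A ∧
  ∃ r a b a' b' : ℝ, 0 < r ∧
    a < b ∧ b - a < 2 * Real.pi ∧ a' < b' ∧ b' - a' < 2 * Real.pi ∧
    (closedArc r a b ∪ -closedArc r a b ∪ closedArc r a' b' ∪ -closedArc r a' b' ⊆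
      frontier (Metric.closedBall (0 : Plane) r) ∩ frontier A) ∧
    List.Pairwise Disjoint
      [openArc r a b, -openArc r a b, openArc r a' b', -openArc r a' b'] ∧
    (∀ x ∈ closedArc r a b, ∃ x' ∈ closedArc r a' b',
      BirkhoffOrthogonal (Metric.closedBall (0 : Plane) r) x x') ∧
    (∀ x' ∈ closedArc r a' b', ∃ x ∈ closedArc r a b,
      BirkhoffOrthogonal (Metric.closedBall (0 : Plane) r) x' x)

/-- `A'` is the image of a smooth strictly convex Auerbach domain under an invertible affine map. -/
def IsAffineImageOfADomain (A' : Set Plane) : Prop :=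
  ∃ A : Set Plane, IsADomain A ∧ IsSmoothDomain A ∧ StrictConvex ℝ A ∧
    ∃ T : Plane ≃ᵃ[ℝ] Plane, A' = T '' A

/-- The space of smooth origin-symmetric strictly convex domains, inside Mathlib's metric space of
nonempty compact sets, whose distance is the Hausdorff distance. -/
def smoothSymmetricDomains : Set (NonemptyCompacts Plane) :=
  {K | IsConvexDomain (K : Set Plane) ∧ IsOSymmetric (K : Set Plane) ∧
    IsSmoothDomain (K : Set Plane) ∧ StrictConvex ℝ (K : Set Plane)}

/-- The length of a subset of the plane: its one-dimensional Hausdorff measure. -/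
noncomputable def planeLength (S : Set Plane) : ENNReal := μH[1] S

/-! The class of domains and the conclusion are stable under linear maps, up to Lipschitz constants.
So `K` may be put in coordinates given by `u, v ∈ K` with |det(u, v)| maximal
(`exists_isNormalized_image`). It then lies in the square [-1, 1]² and contains ±e₁, ±e₂, so its
boundary is tangent to the unit circle at these four points.

Near e₁ the boundary is a graph x = f(y) with f(0) = 1 and f'(0) = 0. For small θ this graph can
follow the unit circle on [0, θ], then a strictly concave C¹ bridge on [θ, η], then f again. The
bridge exists because the chord from the circle point at height θ to (f(η), η) has a slope strictly
between the two end slopes: this holds in the limit θ → 0 by strict concavity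
(`IsCap.exists_modify_right`, `exists_bridge`). Reflecting, swapping coordinates and using central
symmetry gives arcs about ±e₁ and ±e₂. A quarter turn matches the arcs about e₁ and e₂, so the
result is an A-domain (`isADomain_of_arcs`).

Only the strips |x| < η and |y| < η are affected. Both domains lie between the ℓ¹ ball and the
square, so their Hausdorff distance is at most 2η. The boundary length inside the closed strips
tends to 0 with η, because these pieces shrink to four points and the whole boundary has finite
length. -/

/-! ### Gluing strictly concave C¹ graphs -/

/-- The function equal to `f` up to `b` and to `g` from there on. -/
noncomputable def splice (b : ℝ) (f g : ℝ → ℝ) : ℝ → ℝ := fun y => if y ≤ b then f y else g y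

/-- `f` has the strictly decreasing derivative `f'` on `S` (within `S`). -/
structure HasStrictAntiDerivOn (f f' : ℝ → ℝ) (S : Set ℝ) : Prop where
  hasDeriv : ∀ y ∈ S, HasDerivWithinAt f (f' y) S y
  anti : StrictAntiOn f' S

lemma splice_of_le {b y : ℝ} {f g : ℝ → ℝ} (h : y ≤ b) : splice b f g y = f y := if_pos h

lemma splice_of_lt {b y : ℝ} {f g : ℝ → ℝ} (h : b < y) : splice b f g y = g y :=
  if_neg (not_le.2 h)

lemma splice_of_ge {b y : ℝ} {f g : ℝ → ℝ} (hb : f b = g b) (h : b ≤ y) :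
    splice b f g y = g y := by
  rcases h.eq_or_lt with rfl | h
  · rw [splice_of_le le_rfl, hb]
  · exact splice_of_lt h

/-- Functions with strictly decreasing derivatives can be joined where they agree to first
order. -/
lemma HasStrictAntiDerivOn.splice {f f' g g' : ℝ → ℝ} {S T : Set ℝ} {b : ℝ}
    (hf : HasStrictAntiDerivOn f f' S) (hg : HasStrictAntiDerivOn g g' T)
    (hS : IsGreatest S b) (hT : IsLeast T b) (h : f b = g b) (h' : f' b = g' b) :
    HasStrictAntiDerivOn (splice b f g) (splice b f' g') (S ∪ T) := by
  have eS : ∀ y ∈ S, _root_.splice b f g y = f y := fun y hy => splice_of_le (hS.2 hy)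
  have eS' : ∀ y ∈ S, _root_.splice b f' g' y = f' y := fun y hy => splice_of_le (hS.2 hy)
  have eT : ∀ y ∈ T, _root_.splice b f g y = g y := fun y hy => splice_of_ge h (hT.2 hy)
  have eT' : ∀ y ∈ T, _root_.splice b f' g' y = g' y := fun y hy => splice_of_ge h' (hT.2 hy)
  have cS : closure S ⊆ Set.Iic b := closure_minimal hS.2 isClosed_Iic
  have cT : closure T ⊆ Set.Ici b := closure_minimal hT.2 isClosed_Ici
  have dS : ∀ y ∈ S, HasDerivWithinAt (_root_.splice b f g) (f' y) S y := fun y hy =>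
    (hf.hasDeriv y hy).congr eS (eS y hy)
  have dT : ∀ y ∈ T, HasDerivWithinAt (_root_.splice b f g) (g' y) T y := fun y hy =>
    (hg.hasDeriv y hy).congr eT (eT y hy)
  refine ⟨fun y hy => ?_, ?_⟩
  · rcases lt_trichotomy y b with hlt | rfl | hlt
    · have hyS : y ∈ S := hy.resolve_right fun hyT => (hT.2 hyT).not_gt hlt
      rw [eS' y hyS]
      exact (dS y hyS).union (HasFDerivWithinAt.of_notMem_closure fun hc => (cT hc).not_gt hlt)
    · rw [eS' y hS.1]
      refine (dS y hS.1).union ?_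
      rw [h']
      exact dT y hT.1
    · have hyT : y ∈ T := hy.resolve_left fun hyS => (hS.2 hyS).not_gt hlt
      rw [eT' y hyT]
      exact HasDerivWithinAt.union
        (HasFDerivWithinAt.of_notMem_closure fun hc => (cS hc).not_gt hlt) (dT y hyT)
  · exact (hf.anti.congr fun y hy => (eS' y hy).symm).union
      (hg.anti.congr fun y hy => (eT' y hy).symm) hS hT

lemma HasStrictAntiDerivOn.mono {f f' : ℝ → ℝ} {S T : Set ℝ} (h : HasStrictAntiDerivOn f f' T)
    (hST : S ⊆ T) : HasStrictAntiDerivOn f f' S :=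
  ⟨fun y hy => (h.hasDeriv y (hST hy)).mono hST, h.anti.mono hST⟩

/-- Two points can be joined by a graph with strictly decreasing derivative and prescribed slopes
at its ends, whenever the slope of the chord lies strictly between the two. -/
lemma exists_bridge {a b u v s t : ℝ} (hab : a < b) (hs : (v - u) / (b - a) < s)
    (ht : t < (v - u) / (b - a)) :
    ∃ q q' : ℝ → ℝ, HasStrictAntiDerivOn q q' (Set.Icc a b) ∧
      q a = u ∧ q b = v ∧ q' a = s ∧ q' b = t := by
  set m := (v - u) / (b - a) with hm
  set d := b - a with hd
  have d0 : 0 < d := sub_pos.2 hab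
  -- The derivative will be s + (t - s)x^(r-1) with x = (y - a)/d. Its mean s + (t - s)/r must be
  -- the chord slope m, which determines r; then r > 1 amounts to t < m.
  set r := (s - t) / (s - m) with hr
  have sm : 0 < s - m := sub_pos.2 hs
  have st : 0 < s - t := by linarith
  have r1 : 1 < r := by rw [hr, one_lt_div sm]; linarith
  have r0 : 0 < r := by linarith
  refine ⟨fun y => u + s * (y - a) + (t - s) * d / r * ((y - a) / d) ^ r,
    fun y => s + (t - s) * ((y - a) / d) ^ (r - 1), ⟨fun y _ => ?_, ?_⟩, ?_, ?_, ?_, ?_⟩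
  · apply HasDerivAt.hasDerivWithinAt
    have h1 : HasDerivAt (fun y : ℝ => y - a) 1 y := (hasDerivAt_id y).sub_const a
    have h2 := (Real.hasDerivAt_rpow_const (x := (y - a) / d) (p := r) (Or.inr r1.le)).comp y
      (h1.div_const d)
    have h3 := ((h1.const_mul s).const_add u).add (h2.const_mul ((t - s) * d / r))
    refine h3.congr_deriv ?_
    field_simp
  · intro x hx y hy hxy
    have h1 : (x - a) / d < (y - a) / d := by gcongr
    have h2 : 0 ≤ (x - a) / d := div_nonneg (by linarith [hx.1]) d0.le
    have h3 := Real.rpow_lt_rpow h2 h1 (show 0 < r - 1 by linarith)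
    show s + (t - s) * ((y - a) / d) ^ (r - 1) < s + (t - s) * ((x - a) / d) ^ (r - 1)
    nlinarith
  · simp [r0.ne']
  · have : m * d = v - u := by rw [hm]; field_simp
    simp only [← hd, div_self d0.ne', Real.one_rpow, mul_one]
    rw [hr]
    field_simp
    nlinarith
  · simp [show r - 1 ≠ 0 by linarith]
  · simp [← hd, div_self d0.ne']

lemma hasStrictAntiDerivOn_circle :
    HasStrictAntiDerivOn (fun y => √(1 - y ^ 2)) (fun y => -y / √(1 - y ^ 2)) (Set.Ico 0 1) := by
  have pos : ∀ y ∈ Set.Ico (0 : ℝ) 1, 0 < 1 - y ^ 2 := fun y hy => by nlinarith [hy.1, hy.2]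
  refine ⟨fun y hy => ?_, fun x hx y hy hxy => ?_⟩
  · have h1 : HasDerivAt (fun y : ℝ => 1 - y ^ 2) (-(2 * y)) y := by
      simpa using (hasDerivAt_pow 2 y).const_sub 1
    refine ((h1.sqrt (pos y hy).ne').congr_deriv ?_).hasDerivWithinAt
    rw [← mul_neg, mul_div_mul_left _ _ two_ne_zero]
  · have hx' := Real.sqrt_pos.2 (pos x hx)
    have hy' := Real.sqrt_pos.2 (pos y hy)
    have : √(1 - y ^ 2) ≤ √(1 - x ^ 2) := Real.sqrt_le_sqrt (by nlinarith [hx.1])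
    show -y / √(1 - y ^ 2) < -x / √(1 - x ^ 2)
    rw [div_lt_div_iff₀ hy' hx']
    nlinarith [hx.1]

/-! ### Cap functions and their modification near 0 -/

/-- The functions on `[-1, 1]` whose graphs are the right halves of boundaries of smooth strictly
convex domains between the unit ball of the `ℓ¹` norm and that of the maximum norm. -/
structure IsCap (f : ℝ → ℝ) : Prop where
  cont : ContinuousOn f (Set.Icc (-1) 1)
  conc : StrictConcaveOn ℝ (Set.Icc (-1) 1) f
  diff : ∀ y ∈ Set.Ioo (-1 : ℝ) 1, DifferentiableAt ℝ f y
  map_zero : f 0 = 1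
  deriv_zero : deriv f 0 = 0
  map_one : f 1 = 0
  map_neg_one : f (-1) = 0

namespace IsCap

lemma hasStrictAntiDerivOn {f : ℝ → ℝ} (hf : IsCap f) :
    HasStrictAntiDerivOn f (deriv f) (Set.Ioo (-1) 1) :=
  ⟨fun y hy => (hf.diff y hy).hasDerivAt.hasDerivWithinAt,
    (hf.conc.subset Set.Ioo_subset_Icc_self (convex_Ioo _ _)).strictAntiOn_deriv hf.diff⟩

/-- Derivatives of `g` are required only on the open interval; continuity at ±1 is inherited from
`f`, with which `g` agrees near the end points. -/
lemma of_eq_outside {f g g' : ℝ → ℝ} {η : ℝ} (hf : IsCap f) (hη : η < 1)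
    (hg : HasStrictAntiDerivOn g g' (Set.Ioo (-1) 1)) (h : ∀ y, η ≤ |y| → g y = f y)
    (h0 : g 0 = 1) (h0' : g' 0 = 0) : IsCap g := by
  have der : ∀ y ∈ Set.Ioo (-1 : ℝ) 1, HasDerivAt g (g' y) y := fun y hy =>
    (hg.hasDeriv y hy).hasDerivAt (isOpen_Ioo.mem_nhds hy)
  have cont : ContinuousOn g (Set.Icc (-1) 1) := by
    intro y hy
    by_cases hlt : |y| < 1
    · exact (der y (abs_lt.1 hlt)).continuousAt.continuousWithinAt
    · have ho : {z : ℝ | η < |z|} ∈ nhds y :=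
        (isOpen_lt continuous_const continuous_abs).mem_nhds (by
          show η < |y|
          linarith)
      refine (hf.cont y hy).congr_of_eventuallyEq ?_ (h y (by linarith))
      filter_upwards [mem_nhdsWithin_of_mem_nhds ho] with z hz using h z (le_of_lt hz)
  have e1 : (1 : ℝ) = |1| := by simp
  refine ⟨cont, StrictAntiOn.strictConcaveOn_of_deriv (convex_Icc _ _) cont ?_,
    fun y hy => (der y hy).differentiableAt, h0, ?_, ?_, ?_⟩
  · rw [interior_Icc]
    exact hg.anti.congr fun y hy => (der y hy).deriv.symm
  · rw [(der 0 (by norm_num)).deriv, h0']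
  · rw [h 1 (by simpa using hη.le), hf.map_one]
  · rw [h (-1) (by simpa using hη.le), hf.map_neg_one]

/-- The graph of a cap function can be replaced by an arc of the unit circle on a small interval
`[0, θ]`, without changing it outside `[0, η]`. -/
lemma exists_modify_right {f : ℝ → ℝ} (hf : IsCap f) {η : ℝ} (h0 : 0 < η) (h1 : η < 1) :
    ∃ g, IsCap g ∧ (∀ y ≤ 0, g y = f y) ∧ (∀ y, η ≤ y → g y = f y) ∧
      ∃ θ, 0 < θ ∧ θ < η ∧ ∀ y ∈ Set.Icc 0 θ, g y = √(1 - y ^ 2) := by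
  have hη : η ∈ Set.Ioo (-1 : ℝ) 1 := ⟨by linarith, h1⟩
  have z1 : (0 : ℝ) ∈ Set.Icc (-1 : ℝ) 1 := by norm_num
  have s1 : (f η - 1) / (η - 0) < 0 := by
    have := hf.conc.slope_lt_of_hasDerivAt (f' := 0) z1 (Set.Ioo_subset_Icc_self hη) h0
      (by simpa [hf.deriv_zero] using (hf.diff 0 (by norm_num)).hasDerivAt)
    rwa [slope_def_field, hf.map_zero] at this
  have s2 : deriv f η < (f η - 1) / (η - 0) := by
    have := hf.conc.lt_slope_of_hasDerivAt z1 (Set.Ioo_subset_Icc_self hη) h0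
      (hf.diff η hη).hasDerivAt
    rwa [slope_def_field, hf.map_zero] at this
  have c1 : ContinuousAt (fun y : ℝ => (f η - √(1 - y ^ 2)) / (η - y)) 0 :=
    ContinuousAt.div (by fun_prop) (by fun_prop) (by simpa using h0.ne')
  have c2 : ContinuousAt (fun y : ℝ => -y / √(1 - y ^ 2)) 0 :=
    ContinuousAt.div (by fun_prop) (by fun_prop) (by simp)
  -- At y = 0 these inequalities are `s1` and `s2`; by continuity they persist for small y = θ,
  -- giving the slope conditions for the bridge.
  have ev1 : ∀ᶠ y in nhds (0 : ℝ), (f η - √(1 - y ^ 2)) / (η - y) < -y / √(1 - y ^ 2) :=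
    Filter.Tendsto.eventually_lt c1 c2 (by simpa using s1)
  have ev2 : ∀ᶠ y in nhds (0 : ℝ), deriv f η < (f η - √(1 - y ^ 2)) / (η - y) :=
    c1.eventually_const_lt (by simpa using s2)
  have ev : ∀ᶠ y in nhdsWithin (0 : ℝ) (Set.Ioi 0), y ∈ Set.Ioo 0 η ∧
      (f η - √(1 - y ^ 2)) / (η - y) < -y / √(1 - y ^ 2) ∧
      deriv f η < (f η - √(1 - y ^ 2)) / (η - y) := by
    filter_upwards [Ioo_mem_nhdsGT h0, ev1.filter_mono nhdsWithin_le_nhds,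
      ev2.filter_mono nhdsWithin_le_nhds] with y a b c using ⟨a, b, c⟩
  obtain ⟨θ, ⟨t0, t1⟩, hs, ht⟩ := ev.exists
  obtain ⟨q, q', hq, qa, qb, qa', qb'⟩ := exists_bridge t1 hs ht
  have H := hf.hasStrictAntiDerivOn
  have A1 := (H.mono (S := Set.Ioc (-1) 0) fun y hy => ⟨hy.1, by linarith [hy.2]⟩).splice
    (hasStrictAntiDerivOn_circle.mono (S := Set.Icc 0 θ) fun y hy => ⟨hy.1, by linarith [hy.2]⟩)
    (b := 0) ⟨by norm_num, fun y hy => hy.2⟩ ⟨⟨le_rfl, t0.le⟩, fun y hy => hy.1⟩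
    (by simp [hf.map_zero]) (by simp [hf.deriv_zero])
  rw [Set.Ioc_union_Icc_eq_Ioc (by norm_num) t0.le] at A1
  have A2 := A1.splice hq ⟨⟨by linarith, le_rfl⟩, fun y hy => hy.2⟩
    ⟨⟨le_rfl, t1.le⟩, fun y hy => hy.1⟩
    (by rw [splice_of_lt t0, qa]) (by rw [splice_of_lt t0, qa'])
  rw [Set.Ioc_union_Icc_eq_Ioc (by linarith) t1.le] at A2
  have A3 := A2.splice (H.mono (S := Set.Ico η 1) fun y hy => ⟨by linarith [hy.1], hy.2⟩)
    ⟨⟨by linarith, le_rfl⟩, fun y hy => hy.2⟩ ⟨⟨le_rfl, h1⟩, fun y hy => hy.1⟩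
    (by rw [splice_of_lt t1, qb]) (by rw [splice_of_lt t1, qb'])
  rw [Set.Ioc_union_Ico_eq_Ioo (by linarith) h1] at A3
  set g := _root_.splice η (_root_.splice θ (_root_.splice 0 f fun y => √(1 - y ^ 2)) q) f with hg
  have gl : ∀ y ≤ 0, g y = f y := fun y hy => by
    rw [hg, splice_of_le (by linarith), splice_of_le (by linarith), splice_of_le hy]
  have gr : ∀ y, η ≤ y → g y = f y := fun y hy => by
    rw [hg, splice_of_ge (by rw [splice_of_lt t1, qb]) hy]
  refine ⟨g, hf.of_eq_outside h1 A3 (fun y hy => ?_) ?_ ?_, gl, gr, θ, t0, t1, fun y hy => ?_⟩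
  · rcases le_total y 0 with h | h
    · exact gl y h
    · exact gr y (by rwa [abs_of_nonneg h] at hy)
  · rw [gl 0 le_rfl, hf.map_zero]
  · rw [splice_of_le h0.le, splice_of_le t0.le, splice_of_le le_rfl, hf.deriv_zero]
  · rw [hg, splice_of_le (by linarith [hy.2]), splice_of_le hy.2,
      splice_of_ge (by simp [hf.map_zero]) hy.1]

lemma comp_neg {f : ℝ → ℝ} (hf : IsCap f) : IsCap fun y => f (-y) := by
  have hmaps : Set.MapsTo (fun y : ℝ => -y) (Set.Icc (-1) 1) (Set.Icc (-1) 1) := fun y hy =>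
    ⟨by linarith [hy.2], by linarith [hy.1]⟩
  refine ⟨hf.cont.comp continuous_neg.continuousOn hmaps, ⟨convex_Icc _ _, ?_⟩, ?_, ?_, ?_, ?_, ?_⟩
  · intro x hx y hy hxy a b ha hb hab
    have := hf.conc.2 (hmaps hx) (hmaps hy) (by simpa using hxy) ha hb hab
    simp only [smul_eq_mul] at this ⊢
    rwa [show -(a * x + b * y) = a * -x + b * -y by ring]
  · intro y hy
    exact (hf.diff (-y) ⟨by linarith [hy.2], by linarith [hy.1]⟩).comp y
      differentiableAt_id.neg
  · simp [hf.map_zero]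
  · rw [deriv_comp_neg]
    simp [hf.deriv_zero]
  · exact hf.map_neg_one
  · simpa using hf.map_one

/-- The graph of a cap function can be replaced by an arc of the unit circle on a small interval
around `0`, without changing it outside `[-η, η]`. -/
lemma exists_modify {f : ℝ → ℝ} (hf : IsCap f) {η : ℝ} (h0 : 0 < η) (h1 : η < 1) :
    ∃ g, IsCap g ∧ (∀ y, η ≤ |y| → g y = f y) ∧
      ∃ θ, 0 < θ ∧ θ < η ∧ ∀ y, |y| ≤ θ → g y = √(1 - y ^ 2) := by
  obtain ⟨g, hg, gl, gr, θ, t0, t1, gθ⟩ := hf.exists_modify_right h0 h1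
  -- The left side is treated by applying the one-sided result to the reflected function; it leaves
  -- the half already modified untouched.
  obtain ⟨k, hk, kl, kr, ζ, u0, u1, kζ⟩ := hg.comp_neg.exists_modify_right h0 h1
  refine ⟨_, hk.comp_neg, fun y hy => ?_, min θ ζ, lt_min t0 u0, min_lt_of_left_lt t1,
    fun y hy => ?_⟩
  · rcases le_total y 0 with h | h
    · rw [abs_of_nonpos h] at hy
      rw [kr _ hy, neg_neg, gl y h]
    · rw [abs_of_nonneg h] at hy
      rw [kl _ (by linarith), neg_neg, gr y hy]
  · rcases le_total y 0 with h | h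
    · rw [abs_of_nonpos h] at hy
      rw [kζ _ ⟨by linarith, hy.trans (min_le_right _ _)⟩, neg_sq]
    · rw [abs_of_nonneg h] at hy
      rw [kl _ (by linarith), neg_neg, gθ y ⟨h, hy.trans (min_le_left _ _)⟩]

end IsCap

/-! ### Supporting lines and their local nature -/

/-- Smooth origin-symmetric strictly convex domains. -/
structure IsSmoothSymmetricDomain (K : Set Plane) : Prop where
  domain : IsConvexDomain K
  symm : IsOSymmetric K
  smooth : IsSmoothDomain K
  strict : StrictConvex ℝ K

lemma inner_plane (u z : Plane) : inner ℝ u z = u 0 * z 0 + u 1 * z 1 := by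
  simp [PiLp.inner_apply, Fin.sum_univ_two, mul_comm]

lemma plane_ext {z w : Plane} (h0 : z 0 = w 0) (h1 : z 1 = w 1) : z = w := by
  ext i
  fin_cases i
  · exact h0
  · exact h1

lemma IsOSymmetric.neg_mem {K : Set Plane} (h : IsOSymmetric K) {z : Plane} (hz : z ∈ K) :
    -z ∈ K := by
  rw [← h]
  simpa using hz

lemma exists_add_smul_mem_of_mem_interior {K : Set Plane} {z : Plane} (hz : z ∈ interior K)
    (v : Plane) : ∃ t : ℝ, 0 < t ∧ z + t • v ∈ K := by
  have hc : ContinuousAt (fun t : ℝ => z + t • v) 0 := by fun_prop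
  have : ∀ᶠ t in nhdsWithin (0 : ℝ) (Set.Ioi 0), 0 < t ∧ z + t • v ∈ K := by
    filter_upwards [self_mem_nhdsWithin, (hc.eventually_mem (s := K) (by
      simpa using mem_interior_iff_mem_nhds.1 hz)).filter_mono nhdsWithin_le_nhds] with t a b
    exact ⟨a, b⟩
  exact this.exists

lemma mem_frontier_iff_of_eventually {K L : Set Plane} {p : Plane}
    (h : ∀ᶠ z in nhds p, z ∈ K ↔ z ∈ L) : p ∈ frontier K ↔ p ∈ frontier L := by
  rw [frontier_eq_closure_inter_closure, frontier_eq_closure_inter_closure]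
  simp only [Set.mem_inter_iff, mem_closure_iff_frequently, Set.mem_compl_iff]
  rw [Filter.frequently_congr h, Filter.frequently_congr (h.mono fun z hz => not_congr hz)]

/-- Hahn–Banach separates `p` from the interior of `K`; the inequality passes to `K`, which lies in
the closure of its interior. -/
lemma exists_isSupportingLine {K : Set Plane} (hK : IsConvexDomain K) {p : Plane}
    (hp : p ∈ frontier K) : ∃ L, IsSupportingLine K p L := by
  have hpK : p ∈ K := hK.isCompact.isClosed.frontier_subset hp
  obtain ⟨f, hf⟩ := geometric_hahn_banach_open_point hK.convex.interior isOpen_interior hp.2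
  obtain ⟨q, hq⟩ := hK.interior_nonempty
  set u : Plane := (InnerProductSpace.toDual ℝ Plane).symm f with hu
  have hfu : ∀ z, inner ℝ u z = f z := fun z => by simp [hu]
  refine ⟨_, hpK, u, ?_, rfl, fun z hz => ?_⟩
  · rintro h0
    have := hf q hq
    rw [← hfu, ← hfu, h0] at this
    simp at this
  · rw [hfu, hfu]
    have hz' : z ∈ closure (interior K) := by
      rw [hK.convex.closure_interior_eq_closure_of_nonempty_interior hK.interior_nonempty]
      exact subset_closure hz
    exact closure_minimal (fun a ha => (hf a ha).le)
      (isClosed_le f.continuous continuous_const) hz'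

/-- For a convex set, support is a local condition: a point of `L` can be moved along its segment to
`p` until it lies where the two sets agree, and the linear inequality scales back. -/
lemma IsSupportingLine.of_eventually {K L S : Set Plane} {p : Plane} (hL : Convex ℝ L)
    (h : ∀ᶠ z in nhds p, z ∈ K ↔ z ∈ L) (hS : IsSupportingLine K p S) :
    IsSupportingLine L p S := by
  obtain ⟨hp, u, hu, hS, hle⟩ := hS
  have hpL : p ∈ L := h.self_of_nhds.1 hp
  refine ⟨hpL, u, hu, hS, fun z hz => ?_⟩
  have hc : ContinuousAt (fun t : ℝ => p + t • (z - p)) 0 := by fun_prop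
  have ht : Filter.Tendsto (fun t : ℝ => p + t • (z - p)) (nhds 0) (nhds p) := by
    simpa [ContinuousAt] using hc
  have : ∀ᶠ t in nhdsWithin (0 : ℝ) (Set.Ioi 0), t ∈ Set.Ioo (0 : ℝ) 1 ∧
      (p + t • (z - p) ∈ K ↔ p + t • (z - p) ∈ L) := by
    filter_upwards [Ioo_mem_nhdsGT one_pos,
      (ht.eventually h).filter_mono nhdsWithin_le_nhds] with t a b
    exact ⟨a, b⟩
  obtain ⟨t, ⟨t0, t1⟩, ht⟩ := this.exists
  have hK := hle _ (ht.2 (hL.add_smul_sub_mem hpL hz ⟨t0.le, t1.le⟩))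
  rw [inner_add_right, inner_smul_right, inner_sub_right] at hK
  nlinarith

lemma existsUnique_isSupportingLine_of_eventually {K L : Set Plane} {p : Plane}
    (hK : Convex ℝ K) (hL : Convex ℝ L) (h : ∀ᶠ z in nhds p, z ∈ K ↔ z ∈ L)
    (hs : ∃! S, IsSupportingLine K p S) : ∃! S, IsSupportingLine L p S := by
  obtain ⟨S, hS, hu⟩ := hs
  exact ⟨S, hS.of_eventually hL h, fun T hT =>
    hu T (hT.of_eventually hK (h.mono fun z hz => hz.symm))⟩

lemma IsSupportingLine.neg {K S : Set Plane} {p : Plane} (hK : IsOSymmetric K)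
    (hS : IsSupportingLine K p S) : IsSupportingLine K (-p) (-S) := by
  obtain ⟨hp, u, hu, rfl, hle⟩ := hS
  refine ⟨hK.neg_mem hp, -u, neg_ne_zero.2 hu, ?_, fun z hz => ?_⟩
  · ext z
    simp only [Set.mem_neg, Set.mem_ofPred_eq, inner_neg_right, inner_neg_left]
    constructor <;> intro h <;> linarith
  · have := hle _ (hK.neg_mem hz)
    simp only [inner_neg_right, inner_neg_left] at this ⊢
    linarith

/-! ### Regions bounded by cap functions -/

/-- `K` lies between the unit balls of the `ℓ¹` norm and of the maximum norm, as far as its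
points go: it contains the coordinate unit vectors and is contained in the square. -/
structure IsNormalized (K : Set Plane) : Prop where
  right_mem : !₂[(1 : ℝ), 0] ∈ K
  top_mem : !₂[(0 : ℝ), 1] ∈ K
  abs_le : ∀ z ∈ K, |z 0| ≤ 1 ∧ |z 1| ≤ 1

/-- The symmetric set between the graphs of `y ↦ f y` and `y ↦ -f (-y)` over `[-1, 1]`. -/
def capRegion (f : ℝ → ℝ) : Set Plane := {z | |z 1| ≤ 1 ∧ -f (-z 1) ≤ z 0 ∧ z 0 ≤ f (z 1)}

lemma isOSymmetric_capRegion (f : ℝ → ℝ) : IsOSymmetric (capRegion f) := by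
  ext z
  simp only [capRegion, Set.mem_neg, Set.mem_ofPred_eq, PiLp.neg_apply, abs_neg, neg_neg]
  constructor <;> rintro ⟨a, b, c⟩ <;> exact ⟨a, by linarith, by linarith⟩

namespace IsCap

variable {f : ℝ → ℝ}

lemma le_one (hf : IsCap f) {y : ℝ} (hy : |y| ≤ 1) : f y ≤ 1 := by
  have hy' : y ∈ Set.Icc (-1 : ℝ) 1 := abs_le.1 hy
  have h0 : (0 : ℝ) ∈ Set.Icc (-1 : ℝ) 1 := by norm_num
  have hd : HasDerivAt f 0 0 := by
    simpa [hf.deriv_zero] using (hf.diff 0 (by norm_num)).hasDerivAt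
  rcases lt_trichotomy y 0 with h | rfl | h
  · have := hf.conc.concaveOn.le_slope_of_hasDerivAt hy' h0 h hd
    rw [slope_def_field, hf.map_zero, le_div_iff₀ (by linarith)] at this
    linarith
  · exact hf.map_zero.le
  · have := hf.conc.concaveOn.slope_le_of_hasDerivAt h0 hy' h hd
    rw [slope_def_field, hf.map_zero, div_le_iff₀ (by linarith)] at this
    linarith

lemma one_sub_abs_le (hf : IsCap f) {y : ℝ} (hy : |y| ≤ 1) : 1 - |y| ≤ f y := by
  have h0 : (0 : ℝ) ∈ Set.Icc (-1 : ℝ) 1 := by norm_num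
  rcases le_total y 0 with h | h
  · rw [abs_of_nonpos h] at hy ⊢
    have := hf.conc.concaveOn.2 (show (-1 : ℝ) ∈ Set.Icc (-1 : ℝ) 1 by norm_num) h0
      (show 0 ≤ -y by linarith) (show 0 ≤ 1 + y by linarith) (by ring)
    simpa [hf.map_zero, hf.map_neg_one] using this
  · rw [abs_of_nonneg h] at hy ⊢
    have := hf.conc.concaveOn.2 (show (1 : ℝ) ∈ Set.Icc (-1 : ℝ) 1 by norm_num) h0
      (show 0 ≤ y by linarith) (show 0 ≤ 1 - y by linarith) (by ring)
    simpa [hf.map_zero, hf.map_one] using this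

lemma isNormalized_capRegion (hf : IsCap f) : IsNormalized (capRegion f) := by
  refine ⟨?_, ?_, fun z hz => ⟨abs_le.2 ⟨?_, ?_⟩, hz.1⟩⟩
  · simp [capRegion, hf.map_zero]
  · simp [capRegion, hf.map_one, hf.map_neg_one]
  · linarith [hz.2.1, hf.le_one (y := -z 1) (by simpa using hz.1)]
  · linarith [hz.2.2, hf.le_one hz.1]

lemma isClosed_capRegion (hf : IsCap f) : IsClosed (capRegion f) := by
  have hS : IsClosed {z : Plane | |z 1| ≤ 1} := isClosed_le (by fun_prop) (by fun_prop)
  have c1 : ContinuousOn (fun z : Plane => f (z 1)) {z | |z 1| ≤ 1} :=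
    hf.cont.comp (by fun_prop) fun z hz => abs_le.1 hz
  have c2 : ContinuousOn (fun z : Plane => -f (-z 1)) {z | |z 1| ≤ 1} :=
    (hf.comp_neg.cont.comp (by fun_prop) fun z hz => abs_le.1 hz).neg
  have h1 := hS.isClosed_le c2 (show ContinuousOn (fun z : Plane => z 0) _ by fun_prop)
  have h2 := hS.isClosed_le (show ContinuousOn (fun z : Plane => z 0) _ by fun_prop) c1
  convert h1.inter h2 using 1
  ext z
  simp only [capRegion, Set.mem_ofPred_eq, Set.mem_inter_iff]
  tauto

lemma mem_interior_capRegion (hf : IsCap f) {z : Plane} (h : |z 1| < 1)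
    (h1 : -f (-z 1) < z 0) (h2 : z 0 < f (z 1)) : z ∈ interior (capRegion f) := by
  rw [mem_interior_iff_mem_nhds]
  have hy : z 1 ∈ Set.Icc (-1 : ℝ) 1 := abs_le.1 h.le
  have c0 : ContinuousAt (fun w : Plane => w 0) z := by fun_prop
  have c1 : ContinuousAt (fun w : Plane => f (w 1)) z :=
    ContinuousAt.comp (f := fun w : Plane => w 1) (hf.diff _ (abs_lt.1 h)).continuousAt
      (by fun_prop)
  have c2 : ContinuousAt (fun w : Plane => -f (-w 1)) z :=
    (ContinuousAt.comp (f := fun w : Plane => w 1) (hf.comp_neg.diff _ (abs_lt.1 h)).continuousAt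
      (by fun_prop)).neg
  have c3 : ContinuousAt (fun w : Plane => |w 1|) z := by fun_prop
  filter_upwards [c3.eventually_lt continuousAt_const h, c2.eventually_lt c0 h1,
    c0.eventually_lt c1 h2] with w a b c
  exact ⟨a.le, b.le, c.le⟩

/-- On a segment with end points of different heights, strict concavity of both bounding graphs
applies. A horizontal segment is handled separately: it cannot have height ±1, where the slice is a
single point. -/
lemma strictConvex_capRegion (hf : IsCap f) : StrictConvex ℝ (capRegion f) := by
  intro p hp q hq hpq a b ha hb hab
  have hp1 := abs_le.1 hp.1
  have hq1 := abs_le.1 hq.1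
  have e0 : (a • p + b • q) 0 = a * p 0 + b * q 0 := by simp
  have e1 : (a • p + b • q) 1 = a * p 1 + b * q 1 := by simp
  have hb' : b = 1 - a := by linarith
  by_cases h : p 1 = q 1
  · have h0 : p 0 ≠ q 0 := fun h0 => hpq (plane_ext h0 h)
    have e1' : a * p 1 + b * q 1 = p 1 := by rw [← h, hb']; ring
    have hlt : |p 1| < 1 := by
      refine lt_of_le_of_ne hp.1 fun h1 => h0 ?_
      have : f (p 1) = 0 ∧ f (-p 1) = 0 := by
        rcases eq_or_eq_neg_of_abs_eq h1 with h1 | h1 <;>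
          simp [h1, hf.map_one, hf.map_neg_one]
      have hp2 := hp.2
      have hq2 := hq.2
      rw [← h] at hq2
      linarith [hp2.1, hp2.2, hq2.1, hq2.2]
    have hp2 := hp.2
    have hq2 := hq.2
    rw [← h] at hq2
    have k1 : a * p 0 + b * q 0 = p 0 + b * (q 0 - p 0) := by rw [hb']; ring
    have k2 : a * p 0 + b * q 0 = q 0 + a * (p 0 - q 0) := by rw [hb']; ring
    apply hf.mem_interior_capRegion
    · rwa [e1, e1']
    · rw [e0, e1, e1']
      rcases lt_or_gt_of_ne h0 with h0 | h0
      · linarith [mul_pos hb (sub_pos.2 h0)]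
      · linarith [mul_pos ha (sub_pos.2 h0)]
    · rw [e0, e1, e1']
      rcases lt_or_gt_of_ne h0 with h0 | h0
      · linarith [mul_pos ha (sub_pos.2 h0)]
      · linarith [mul_pos hb (sub_pos.2 h0)]
  · have s1 := hf.conc.2 hp1 hq1 h ha hb hab
    have s2 := hf.comp_neg.conc.2 hp1 hq1 h ha hb hab
    simp only [smul_eq_mul] at s1 s2
    apply hf.mem_interior_capRegion
    · rw [e1, abs_lt]
      rcases lt_or_gt_of_ne h with h | h <;> constructor <;> nlinarith
    · rw [e0, e1]
      nlinarith [hp.2.1, hq.2.1]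
    · rw [e0, e1]
      nlinarith [hp.2.2, hq.2.2]

lemma isConvexDomain_capRegion (hf : IsCap f) : IsConvexDomain (capRegion f) := by
  refine ⟨Metric.isCompact_of_isClosed_isBounded hf.isClosed_capRegion ?_,
    hf.strictConvex_capRegion.convex, 0, ?_⟩
  · refine (Metric.isBounded_closedBall (x := (0 : Plane)) (r := √2)).subset fun z hz => ?_
    have h := hf.isNormalized_capRegion.abs_le z hz
    rw [mem_closedBall_zero_iff, EuclideanSpace.norm_eq]
    apply Real.sqrt_le_sqrt
    rw [Fin.sum_univ_two]
    simp only [Real.norm_eq_abs]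
    nlinarith [abs_nonneg (z 0), abs_nonneg (z 1)]
  · apply hf.mem_interior_capRegion <;> simp [hf.map_zero]

lemma graph_mem_capRegion (hf : IsCap f) {y : ℝ} (hy : |y| ≤ 1) : !₂[f y, y] ∈ capRegion f := by
  have := hf.one_sub_abs_le hy
  have := hf.one_sub_abs_le (y := -y) (by simpa using hy)
  rw [abs_neg] at this
  refine ⟨by simpa using hy, ?_, by simp⟩
  simp
  linarith

lemma graph_mem_frontier_capRegion (hf : IsCap f) {y : ℝ} (hy : |y| ≤ 1) :
    !₂[f y, y] ∈ frontier (capRegion f) := by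
  rw [hf.isClosed_capRegion.frontier_eq]
  refine ⟨hf.graph_mem_capRegion hy, fun h => ?_⟩
  obtain ⟨t, ht, hm⟩ := exists_add_smul_mem_of_mem_interior h !₂[1, 0]
  have := hm.2.2
  simp at this
  linarith

/-- Along the graph, the linear functional of the normal has a local maximum at `y`, so Fermat's
condition fixes the normal up to a factor. -/
lemma isSupportingLine_graph (hf : IsCap f) {y : ℝ} (hy : |y| < 1) {S : Set Plane}
    (hS : IsSupportingLine (capRegion f) !₂[f y, y] S) :
    S = {z | z 0 - deriv f y * z 1 = f y - deriv f y * y} := by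
  obtain ⟨-, u, hu, rfl, hle⟩ := hS
  simp only [inner_plane] at hle ⊢
  have hmax : IsLocalMax (fun t => u 0 * f t + u 1 * t) y := by
    have : ∀ᶠ t in nhds y, |t| < 1 := continuous_abs.continuousAt.eventually_lt
      continuousAt_const hy
    filter_upwards [this] with t ht
    simpa using hle _ (hf.graph_mem_capRegion ht.le)
  have hd := hmax.hasDerivAt_eq_zero
    (((hf.diff y (abs_lt.1 hy)).hasDerivAt.const_mul (u 0)).add ((hasDerivAt_id y).const_mul (u 1)))
  have h1 : u 1 = -(u 0 * deriv f y) := by linarith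
  have h0 : u 0 ≠ 0 := fun h0 => hu (plane_ext (by simpa using h0) (by simp [h1, h0]))
  ext z
  simp only [Set.mem_ofPred_eq, h1]
  simp
  rw [← mul_right_inj' h0 (b := z 0 - deriv f y * z 1)]
  constructor <;> intro h <;> linarith

lemma eq_of_isSupportingLine_capRegion (hf : IsCap f) {p : Plane} (hp : |p 1| < 1)
    (hpf : p ∈ frontier (capRegion f)) {S T : Set Plane} (hS : IsSupportingLine (capRegion f) p S)
    (hT : IsSupportingLine (capRegion f) p T) : S = T := by
  have hpm := hf.isClosed_capRegion.frontier_subset hpf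
  by_cases h : p 0 = f (p 1)
  · have e : p = !₂[f (p 1), p 1] := plane_ext (by simpa using h) (by simp)
    rw [e] at hS hT
    rw [hf.isSupportingLine_graph hp hS, hf.isSupportingLine_graph hp hT]
  -- A frontier point off the right graph lies on the left one, and central symmetry carries it to
  -- the right graph.
  · have h' : p 0 = -f (-p 1) := by
      by_contra h'
      exact hpf.2 (hf.mem_interior_capRegion hp (lt_of_le_of_ne hpm.2.1 (Ne.symm h'))
        (lt_of_le_of_ne hpm.2.2 h))
    have e : -p = !₂[f (-p 1), -p 1] := plane_ext (by simp [h']) (by simp)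
    have hS' := hS.neg (isOSymmetric_capRegion f)
    have hT' := hT.neg (isOSymmetric_capRegion f)
    rw [e] at hS' hT'
    have hp' : |-p 1| < 1 := by simpa using hp
    have := (hf.isSupportingLine_graph hp' hS').trans (hf.isSupportingLine_graph hp' hT').symm
    exact neg_injective this

/-- A region under a cap function is smooth if it agrees near the points of height `±1` with a
smooth convex set. -/
lemma isSmoothSymmetricDomain_capRegion (hf : IsCap f) {K : Set Plane} {η : ℝ} (hη : η < 1)
    (hK : IsSmoothSymmetricDomain K) (h : ∀ z : Plane, η ≤ |z 1| → (z ∈ K ↔ z ∈ capRegion f)) :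
    IsSmoothSymmetricDomain (capRegion f) := by
  refine ⟨hf.isConvexDomain_capRegion, isOSymmetric_capRegion f, fun p hp => ?_,
    hf.strictConvex_capRegion⟩
  by_cases hlt : |p 1| < 1
  · obtain ⟨S, hS⟩ := exists_isSupportingLine hf.isConvexDomain_capRegion hp
    exact ⟨S, hS, fun T hT => hf.eq_of_isSupportingLine_capRegion hlt hp hT hS⟩
  · have c : ContinuousAt (fun w : Plane => |w 1|) p := by fun_prop
    have ev : ∀ᶠ z in nhds p, z ∈ K ↔ z ∈ capRegion f := by
      filter_upwards [continuousAt_const.eventually_lt c (show η < |p 1| by linarith)] with z hz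
      exact h z (le_of_lt hz)
    exact existsUnique_isSupportingLine_of_eventually hK.domain.convex
      hf.isConvexDomain_capRegion.convex ev
      (hK.smooth p ((mem_frontier_iff_of_eventually ev).2 hp))

end IsCap

/-! ### The boundary of a normalized domain as a cap function -/

/-- The largest abscissa of a point of `K` at height `y`. -/
noncomputable def rightBoundary (K : Set Plane) (y : ℝ) : ℝ := sSup {x | !₂[x, y] ∈ K}

section Cap

variable {K : Set Plane}

lemma zero_mem_of_normalized (hK : IsSmoothSymmetricDomain K) (hN : IsNormalized K) {y : ℝ}
    (hy : |y| ≤ 1) : !₂[0, y] ∈ K := by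
  have h1 := hN.top_mem
  have h2 := hK.symm.neg_mem h1
  have hy' := abs_le.1 hy
  have := hK.domain.convex h1 h2 (show 0 ≤ (1 + y) / 2 by linarith)
    (show 0 ≤ (1 - y) / 2 by linarith) (by ring)
  convert this using 1
  apply plane_ext <;> simp
  ring

lemma isGreatest_rightBoundary (hK : IsSmoothSymmetricDomain K) (hN : IsNormalized K) {y : ℝ}
    (hy : |y| ≤ 1) : IsGreatest {x | !₂[x, y] ∈ K} (rightBoundary K y) := by
  apply IsCompact.isGreatest_sSup
  · have hc : Continuous fun x : ℝ => (!₂[x, y] : Plane) := by fun_prop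
    exact Metric.isCompact_of_isClosed_isBounded (hK.domain.isCompact.isClosed.preimage hc)
      ((Metric.isBounded_Icc (-1) 1).subset fun x hx => by
        simpa using abs_le.1 (hN.abs_le _ hx).1)
  · exact ⟨0, zero_mem_of_normalized hK hN hy⟩

lemma rightBoundary_mem (hK : IsSmoothSymmetricDomain K) (hN : IsNormalized K) {y : ℝ}
    (hy : |y| ≤ 1) : !₂[rightBoundary K y, y] ∈ K := (isGreatest_rightBoundary hK hN hy).1

lemma le_rightBoundary (hK : IsSmoothSymmetricDomain K) (hN : IsNormalized K) {z : Plane}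
    (hz : z ∈ K) : z 0 ≤ rightBoundary K (z 1) := by
  apply (isGreatest_rightBoundary hK hN (hN.abs_le z hz).2).2
  show !₂[z 0, z 1] ∈ K
  rwa [show (!₂[z 0, z 1] : Plane) = z from plane_ext (by simp) (by simp)]

lemma eq_capRegion_rightBoundary (hK : IsSmoothSymmetricDomain K) (hN : IsNormalized K) :
    K = capRegion (rightBoundary K) := by
  ext z
  constructor
  · intro hz
    refine ⟨(hN.abs_le z hz).2, ?_, le_rightBoundary hK hN hz⟩
    have := le_rightBoundary hK hN (hK.symm.neg_mem hz)
    simp only [PiLp.neg_apply] at this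
    linarith
  · rintro ⟨h, h1, h2⟩
    have m1 := rightBoundary_mem hK hN h
    have m2 := hK.symm.neg_mem (rightBoundary_mem hK hN (y := -z 1) (by simpa using h))
    set a := rightBoundary K (z 1)
    set b := rightBoundary K (-z 1)
    rcases (h1.trans h2).eq_or_lt with h3 | h3
    · rwa [show z = !₂[a, z 1] from plane_ext (by simp; linarith) (by simp)]
    · have := hK.domain.convex m1 m2 (show 0 ≤ (z 0 + b) / (a + b) from
        div_nonneg (by linarith) (by linarith)) (show 0 ≤ (a - z 0) / (a + b) from
        div_nonneg (by linarith) (by linarith)) (by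
          have : a + b ≠ 0 := by linarith
          field_simp
          ring)
      convert this using 1
      have : a + b ≠ 0 := by linarith
      apply plane_ext <;> simp <;> field_simp <;> ring

/-- If the slice at height ±1 contained a point besides (0, y), strict convexity would make their
midpoint interior, and `K` would leave the square. -/
lemma rightBoundary_eq_zero (hK : IsSmoothSymmetricDomain K) (hN : IsNormalized K) {y : ℝ}
    (hy : |y| = 1) : rightBoundary K y = 0 := by
  by_contra h
  have m1 := rightBoundary_mem hK hN hy.le
  have m2 := zero_mem_of_normalized hK hN hy.le
  have hi := hK.strict m1 m2 (fun e => h (by simpa using congrArg (fun z : Plane => z 0) e))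
    (show (0 : ℝ) < 1 / 2 by norm_num) (show (0 : ℝ) < 1 / 2 by norm_num) (by norm_num)
  obtain ⟨t, ht, hm⟩ := exists_add_smul_mem_of_mem_interior hi !₂[0, y]
  have := (hN.abs_le _ hm).2
  simp at this
  rw [show 2⁻¹ * y + 2⁻¹ * y + t * y = (1 + t) * y by ring, abs_mul, hy, mul_one,
    abs_of_pos (by linarith)] at this
  linarith

lemma strictConcaveOn_rightBoundary (hK : IsSmoothSymmetricDomain K) (hN : IsNormalized K) :
    StrictConcaveOn ℝ (Set.Icc (-1) 1) (rightBoundary K) := by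
  refine ⟨convex_Icc _ _, fun x hx y hy hxy a b ha hb hab => ?_⟩
  have hi := hK.strict (rightBoundary_mem hK hN (abs_le.2 hx)) (rightBoundary_mem hK hN (abs_le.2 hy))
    (fun e => hxy (by simpa using congrArg (fun z : Plane => z 1) e)) ha hb hab
  obtain ⟨t, ht, hm⟩ := exists_add_smul_mem_of_mem_interior hi !₂[1, 0]
  have := le_rightBoundary hK hN hm
  simp at this ⊢
  linarith

lemma continuousOn_rightBoundary (hK : IsSmoothSymmetricDomain K) (hN : IsNormalized K) :
    ContinuousOn (rightBoundary K) (Set.Icc (-1) 1) := by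
  intro y hy
  by_cases hlt : |y| < 1
  · have := (strictConcaveOn_rightBoundary hK hN).concaveOn.continuousOn_interior
    rw [interior_Icc] at this
    exact (this.continuousAt (isOpen_Ioo.mem_nhds (abs_lt.1 hlt))).continuousWithinAt
  · have hy1 : |y| = 1 := le_antisymm (abs_le.2 hy) (not_lt.1 hlt)
    have h0 := rightBoundary_eq_zero hK hN hy1
    rw [ContinuousWithinAt, h0, tendsto_order]
    refine ⟨fun c hc => ?_, fun c hc => ?_⟩
    · filter_upwards [self_mem_nhdsWithin] with z hz
      exact hc.trans_le ((isGreatest_rightBoundary hK hN (abs_le.2 hz)).2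
        (zero_mem_of_normalized hK hN (abs_le.2 hz)))
    -- Upper semicontinuity at the end points: the heights of points of `K` with abscissa at least c
    -- form a closed set that misses `y`.
    · have hC : IsCompact (K ∩ {z : Plane | c ≤ z 0}) :=
        hK.domain.isCompact.inter_right (isClosed_le continuous_const (by fun_prop))
      have hI := (hC.image (f := fun z : Plane => z 1) (by fun_prop)).isClosed
      have hn : y ∉ (fun z : Plane => z 1) '' (K ∩ {z : Plane | c ≤ z 0}) := by
        rintro ⟨z, ⟨hz, hcz⟩, rfl⟩
        have h1 := le_rightBoundary hK hN hz
        simp only [Set.mem_ofPred_eq] at hcz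
        linarith
      filter_upwards [self_mem_nhdsWithin,
        mem_nhdsWithin_of_mem_nhds (hI.isOpen_compl.mem_nhds hn)] with z hz hzn
      by_contra h
      exact hzn ⟨_, ⟨rightBoundary_mem hK hN (abs_le.2 hz), by simpa using h⟩, by simp⟩

/-- Concavity gives one-sided derivatives r ≤ l, and every s in [r, l] is the slope of a supporting
line. Smoothness of `K` allows only one such line, hence r = l. -/
lemma differentiableAt_rightBoundary (hK : IsSmoothSymmetricDomain K) (hN : IsNormalized K)
    {y : ℝ} (hy : y ∈ Set.Ioo (-1 : ℝ) 1) : DifferentiableAt ℝ (rightBoundary K) y := by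
  set f := rightBoundary K with hf
  have hc : ConcaveOn ℝ (Set.Icc (-1) 1) f := (strictConcaveOn_rightBoundary hK hN).concaveOn
  have hi : y ∈ interior (Set.Icc (-1 : ℝ) 1) := by rwa [interior_Icc]
  have hyI := Set.Ioo_subset_Icc_self hy
  have hr : HasDerivWithinAt f (derivWithin f (Set.Ioi y) y) (Set.Ioi y) y := by
    have := (hc.neg.hasDerivWithinAt_rightDeriv_of_mem_interior hi).neg
    simp only [neg_neg] at this
    exact this.differentiableWithinAt.hasDerivWithinAt
  have hl : HasDerivWithinAt f (derivWithin f (Set.Iio y) y) (Set.Iio y) y := by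
    have := (hc.neg.hasDerivWithinAt_leftDeriv_of_mem_interior hi).neg
    simp only [neg_neg] at this
    exact this.differentiableWithinAt.hasDerivWithinAt
  set r := derivWithin f (Set.Ioi y) y
  set l := derivWithin f (Set.Iio y) y
  have hrs : ∀ x ∈ Set.Icc (-1 : ℝ) 1, y < x → f x - f y ≤ r * (x - y) := fun x hx h => by
    have := hc.slope_le_of_hasDerivWithinAt_Ioi hyI hx h hr
    rwa [slope_def_field, div_le_iff₀ (by linarith)] at this
  have hls : ∀ x ∈ Set.Icc (-1 : ℝ) 1, x < y → l * (y - x) ≤ f y - f x := fun x hx h => by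
    have := hc.le_slope_of_hasDerivWithinAt_Iio hx hyI h hl
    rwa [slope_def_field, le_div_iff₀ (by linarith)] at this
  have hrl : r ≤ l := by
    have h := hc.neg.leftDeriv_le_rightDeriv_of_mem_interior hi
    have e : ∀ S, derivWithin (-f) S y = -derivWithin f S y := fun S => derivWithin.neg
    rw [e, e] at h
    linarith
  have hp := rightBoundary_mem hK hN (abs_le.2 hyI)
  have hpf : !₂[f y, y] ∈ frontier K := by
    rw [hK.domain.isCompact.isClosed.frontier_eq]
    refine ⟨hp, fun h => ?_⟩
    obtain ⟨t, ht, hm⟩ := exists_add_smul_mem_of_mem_interior h !₂[1, 0]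
    have := le_rightBoundary hK hN hm
    simp [← hf] at this
    linarith
  have supp : ∀ s, r ≤ s → s ≤ l → IsSupportingLine K !₂[f y, y]
      {z | inner ℝ (!₂[1, -s] : Plane) z = inner ℝ (!₂[1, -s] : Plane) !₂[f y, y]} := by
    intro s h1 h2
    refine ⟨hp, !₂[1, -s], fun h => ?_, rfl, fun z hz => ?_⟩
    · simpa using congrArg (fun z : Plane => z 0) h
    · have hz0 := le_rightBoundary hK hN hz
      have hz1 : z 1 ∈ Set.Icc (-1 : ℝ) 1 := abs_le.1 (hN.abs_le z hz).2
      simp [inner_plane]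
      rcases lt_trichotomy (z 1) y with h | h | h
      · nlinarith [hls _ hz1 h]
      · rw [h] at hz0 ⊢
        linarith
      · nlinarith [hrs _ hz1 h]
  obtain ⟨S, -, hu⟩ := hK.smooth _ hpf
  have heq := (hu _ (supp r le_rfl hrl)).trans (hu _ (supp l hrl le_rfl)).symm
  -- This point lies on the line of slope parameter r; membership in the line for l forces l = r.
  have hm : (!₂[f y + r, y + 1] : Plane) ∈
      {z | inner ℝ (!₂[1, -r] : Plane) z = inner ℝ (!₂[1, -r] : Plane) !₂[f y, y]} := by
    simp [inner_plane]
    ring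
  rw [heq] at hm
  simp [inner_plane] at hm
  have hlr : l = r := by linarith
  rw [hlr] at hl
  have h3 := hl.Iic_of_Iio.union hr.Ici_of_Ioi
  rw [Set.Iic_union_Ici, hasDerivWithinAt_univ] at h3
  exact h3.differentiableAt

lemma isCap_rightBoundary (hK : IsSmoothSymmetricDomain K) (hN : IsNormalized K) :
    IsCap (rightBoundary K) := by
  have h0 : rightBoundary K 0 = 1 := by
    apply le_antisymm
    · simpa using (abs_le.1 (hN.abs_le _ (rightBoundary_mem hK hN (y := 0) (by simp))).1).2
    · simpa using le_rightBoundary hK hN hN.right_mem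
  refine ⟨continuousOn_rightBoundary hK hN, strictConcaveOn_rightBoundary hK hN,
    fun y hy => differentiableAt_rightBoundary hK hN hy, h0, ?_,
    rightBoundary_eq_zero hK hN (by simp), rightBoundary_eq_zero hK hN (by simp)⟩
  apply IsLocalMax.deriv_eq_zero
  have : ∀ᶠ t in nhds (0 : ℝ), |t| < 1 :=
    continuous_abs.continuousAt.eventually_lt continuousAt_const (by simp)
  filter_upwards [this] with t ht
  rw [h0]
  simpa using (abs_le.1 (hN.abs_le _ (rightBoundary_mem hK hN ht.le)).1).2

end Cap

/-! ### Inserting circular arcs -/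

/-- A normalized domain can be modified close to the first coordinate axis so that its boundary
contains an arc of the unit circle there. -/
lemma exists_arc_right {K : Set Plane} (hK : IsSmoothSymmetricDomain K) (hN : IsNormalized K)
    {η : ℝ} (h0 : 0 < η) (h1 : η < 1) :
    ∃ K', IsSmoothSymmetricDomain K' ∧ IsNormalized K' ∧
      (∀ z : Plane, η ≤ |z 1| → (z ∈ K ↔ z ∈ K')) ∧
      ∃ θ, 0 < θ ∧ θ < η ∧ ∀ y, |y| ≤ θ → !₂[√(1 - y ^ 2), y] ∈ frontier K' := by
  obtain ⟨g, hg, he, θ, t0, t1, hθ⟩ := (isCap_rightBoundary hK hN).exists_modify h0 h1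
  have hag : ∀ z : Plane, η ≤ |z 1| → (z ∈ K ↔ z ∈ capRegion g) := fun z hz => by
    have hz' : η ≤ |-z 1| := by simpa using hz
    conv_lhs => rw [eq_capRegion_rightBoundary hK hN]
    simp only [capRegion, Set.mem_ofPred_eq, he _ hz, he _ hz']
  refine ⟨capRegion g, hg.isSmoothSymmetricDomain_capRegion h1 hK hag,
    hg.isNormalized_capRegion, hag, θ, t0, t1, fun y hy => ?_⟩
  rw [← hθ y hy]
  exact hg.graph_mem_frontier_capRegion (by linarith)

section Linear

variable (L : Plane ≃L[ℝ] Plane) {K S : Set Plane} {p : Plane}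

lemma image_frontier_linear (K : Set Plane) : L '' frontier K = frontier (L '' K) :=
  L.toHomeomorph.image_frontier K

lemma IsSupportingLine.image (hS : IsSupportingLine K p S) :
    IsSupportingLine (L '' K) (L p) (L '' S) := by
  obtain ⟨hp, u, hu, rfl, hle⟩ := hS
  have key : ∀ z, inner ℝ ((L.symm : Plane →L[ℝ] Plane).adjoint u) z = inner ℝ u (L.symm z) :=
    fun z => ContinuousLinearMap.adjoint_inner_left _ _ _
  -- Normals transform by the inverse adjoint.
  refine ⟨⟨p, hp, rfl⟩, (L.symm : Plane →L[ℝ] Plane).adjoint u, fun h => hu ?_, ?_, ?_⟩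
  · have := key (L u)
    rw [h, inner_zero_left, L.symm_apply_apply] at this
    exact inner_self_eq_zero.1 this.symm
  · ext z
    rw [L.image_eq_preimage_symm]
    simp [key]
  · rintro _ ⟨z, hz, rfl⟩
    simpa [key] using hle z hz

lemma IsSmoothSymmetricDomain.image (hK : IsSmoothSymmetricDomain K) :
    IsSmoothSymmetricDomain (L '' K) := by
  refine ⟨⟨hK.domain.isCompact.image L.continuous, ?_, ?_⟩, ?_, ?_, ?_⟩
  · exact hK.domain.convex.linear_image (L : Plane →ₗ[ℝ] Plane)
  · have : L '' interior K = interior (L '' K) := L.toHomeomorph.image_interior K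
    rw [← this]
    exact hK.domain.interior_nonempty.image _
  · have : -(L '' K) = L '' (-K) := by
      ext z
      rw [Set.mem_neg, L.image_eq_preimage_symm, L.image_eq_preimage_symm]
      simp
    rw [IsOSymmetric, this, hK.symm]
  · intro q hq
    rw [← image_frontier_linear] at hq
    obtain ⟨p, hp, rfl⟩ := hq
    obtain ⟨S, hS, hu⟩ := hK.smooth p hp
    refine ⟨L '' S, hS.image L, fun T hT => ?_⟩
    have h := hT.image L.symm
    rw [L.symm_apply_apply, L.symm_image_image] at h
    rw [← hu _ h]
    exact (L.image_symm_image T).symm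
  · exact hK.strict.linear_image (L : Plane →ₗ[ℝ] Plane) L.toHomeomorph.isOpenMap

end Linear

/-- The reflection interchanging the two coordinates. -/
noncomputable def coordSwap : Plane ≃L[ℝ] Plane :=
  (LinearIsometryEquiv.piLpCongrLeft 2 ℝ ℝ (Equiv.swap (0 : Fin 2) 1)).toContinuousLinearEquiv

lemma coordSwap_apply_zero (z : Plane) : coordSwap z 0 = z 1 := by
  simp [coordSwap, LinearIsometryEquiv.piLpCongrLeft_apply]

lemma coordSwap_apply_one (z : Plane) : coordSwap z 1 = z 0 := by
  simp [coordSwap, LinearIsometryEquiv.piLpCongrLeft_apply]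

lemma coordSwap_coordSwap (z : Plane) : coordSwap (coordSwap z) = z :=
  plane_ext (by rw [coordSwap_apply_zero, coordSwap_apply_one])
    (by rw [coordSwap_apply_one, coordSwap_apply_zero])

lemma mem_coordSwap_image {K : Set Plane} {z : Plane} :
    z ∈ coordSwap '' K ↔ coordSwap z ∈ K := by
  constructor
  · rintro ⟨w, hw, rfl⟩
    rwa [coordSwap_coordSwap]
  · exact fun h => ⟨_, h, coordSwap_coordSwap z⟩

lemma coordSwap_vec (a b : ℝ) : coordSwap !₂[a, b] = !₂[b, a] :=
  plane_ext (by simp [coordSwap_apply_zero]) (by simp [coordSwap_apply_one])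

lemma IsNormalized.coordSwap_image {K : Set Plane} (hN : IsNormalized K) :
    IsNormalized (coordSwap '' K) := by
  refine ⟨?_, ?_, ?_⟩
  · rw [mem_coordSwap_image, coordSwap_vec]
    exact hN.top_mem
  · rw [mem_coordSwap_image, coordSwap_vec]
    exact hN.right_mem
  · rintro _ ⟨z, hz, rfl⟩
    rw [coordSwap_apply_zero, coordSwap_apply_one]
    exact (hN.abs_le z hz).symm

/-- A normalized domain can be modified close to the second coordinate axis so that its boundary
contains an arc of the unit circle there. -/
lemma exists_arc_top {K : Set Plane} (hK : IsSmoothSymmetricDomain K) (hN : IsNormalized K)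
    {η : ℝ} (h0 : 0 < η) (h1 : η < 1) :
    ∃ K', IsSmoothSymmetricDomain K' ∧ IsNormalized K' ∧
      (∀ z : Plane, η ≤ |z 0| → (z ∈ K ↔ z ∈ K')) ∧
      ∃ θ, 0 < θ ∧ θ < η ∧ ∀ x, |x| ≤ θ → !₂[x, √(1 - x ^ 2)] ∈ frontier K' := by
  obtain ⟨K', hK', hN', hag, θ, t0, t1, hθ⟩ :=
    exists_arc_right (hK.image coordSwap) hN.coordSwap_image h0 h1
  refine ⟨coordSwap '' K', hK'.image _, hN'.coordSwap_image, fun z hz => ?_, θ, t0, t1,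
    fun x hx => ?_⟩
  · rw [mem_coordSwap_image, ← hag _ (by rwa [coordSwap_apply_one]), mem_coordSwap_image,
      coordSwap_coordSwap]
  · rw [← image_frontier_linear, mem_coordSwap_image, coordSwap_vec]
    exact hθ x hx

/-! ### Arcs about the axes give an A-domain -/

lemma IsOSymmetric.neg_mem_frontier {K : Set Plane} (h : IsOSymmetric K) {z : Plane}
    (hz : z ∈ frontier K) : -z ∈ frontier K := by
  have := (Homeomorph.neg Plane).preimage_frontier K
  have e : (Homeomorph.neg Plane) ⁻¹' K = K := h
  rw [e] at this
  rw [← this] at hz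
  exact hz

lemma norm_circlePoint_one (t : ℝ) : ‖circlePoint 1 t‖ = 1 := by
  rw [EuclideanSpace.norm_eq, Fin.sum_univ_two]
  simp [circlePoint]

lemma birkhoffOrthogonal_circlePoint {s t : ℝ} (h : Real.cos (s - t) = 0) :
    BirkhoffOrthogonal (Metric.closedBall (0 : Plane) 1) (circlePoint 1 s) (circlePoint 1 t) := by
  have ne : ∀ u, circlePoint 1 u ≠ 0 := fun u hu => by
    have := norm_circlePoint_one u
    rw [hu, norm_zero] at this
    exact zero_ne_one this
  refine ⟨ne s, ne t, fun c => ?_⟩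
  rw [gauge_closedBall zero_le_one, gauge_closedBall zero_le_one, div_one, div_one]
  have hi : inner ℝ (circlePoint 1 s) (c • circlePoint 1 t) = 0 := by
    rw [inner_smul_right, inner_plane]
    simp [circlePoint, ← Real.cos_sub, h]
  have := norm_add_sq_real (circlePoint 1 s) (c • circlePoint 1 t)
  rw [hi] at this
  exact le_of_sq_le_sq (by nlinarith [sq_nonneg ‖c • circlePoint 1 t‖]) (norm_nonneg _)

/-- A symmetric convex domain whose boundary contains circular arcs about `(1, 0)` and `(0, 1)` is
an Auerbach domain. -/
lemma isADomain_of_arcs {K : Set Plane} (hK : IsConvexDomain K) (hs : IsOSymmetric K) {θ : ℝ}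
    (t0 : 0 < θ) (t1 : θ < 1 / 2) (hr : ∀ y, |y| ≤ θ → !₂[√(1 - y ^ 2), y] ∈ frontier K)
    (ht : ∀ x, |x| ≤ θ → !₂[x, √(1 - x ^ 2)] ∈ frontier K) : IsADomain K := by
  have cpos : ∀ t, |t| ≤ θ → 1 / 2 < Real.cos t ∧ |Real.sin t| ≤ θ ∧
      √(1 - Real.sin t ^ 2) = Real.cos t := by
    intro t h
    have h1 : t ^ 2 ≤ θ ^ 2 := sq_le_sq' (by linarith [neg_abs_le t]) (by linarith [le_abs_self t])
    have h2 := Real.one_sub_sq_div_two_le_cos (x := t)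
    have h3 : 1 / 2 < Real.cos t := by nlinarith
    refine ⟨h3, (Real.abs_sin_le_abs).trans h, ?_⟩
    rw [← Real.cos_sq', Real.sqrt_sq (by linarith)]
  have right : ∀ t, |t| ≤ θ → circlePoint 1 t ∈ frontier K ∧ 1 / 2 < circlePoint 1 t 0 ∧
      |circlePoint 1 t 1| < 1 / 2 := by
    intro t h
    obtain ⟨h1, h2, h3⟩ := cpos t h
    have h4 := hr _ h2
    rw [h3] at h4
    simp only [circlePoint, one_mul]
    exact ⟨h4, by simpa using h1, by simpa using h2.trans_lt t1⟩
  have top : ∀ t, |t - Real.pi / 2| ≤ θ → circlePoint 1 t ∈ frontier K ∧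
      1 / 2 < circlePoint 1 t 1 := by
    intro t h
    obtain ⟨h1, h2, h3⟩ := cpos _ h
    rw [Real.sin_sub_pi_div_two, abs_neg] at h2
    rw [Real.sin_sub_pi_div_two, neg_sq] at h3
    have h4 := ht _ h2
    rw [h3] at h4
    rw [Real.cos_sub_pi_div_two] at h1 h4
    simp only [circlePoint, one_mul]
    exact ⟨h4, by simpa using h1⟩
  have absr : ∀ t ∈ Set.Icc (-θ) θ, |t| ≤ θ := fun t h => abs_le.2 h
  have abst : ∀ t ∈ Set.Icc (Real.pi / 2 - θ) (Real.pi / 2 + θ), |t - Real.pi / 2| ≤ θ :=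
    fun t h => abs_le.2 ⟨by linarith [h.1], by linarith [h.2]⟩
  have hpi := Real.pi_gt_three
  refine ⟨hK, hs, 1, -θ, θ, Real.pi / 2 - θ, Real.pi / 2 + θ, one_pos, by linarith, by linarith,
    by linarith, by linarith, ?_, ?_, ?_, ?_⟩
  · have main : ∀ z, (z ∈ closedArc 1 (-θ) θ ∪ closedArc 1 (Real.pi / 2 - θ) (Real.pi / 2 + θ)) →
        ‖z‖ = 1 ∧ z ∈ frontier K := by
      rintro z (⟨t, h, rfl⟩ | ⟨t, h, rfl⟩)
      · exact ⟨norm_circlePoint_one t, (right t (absr t h)).1⟩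
      · exact ⟨norm_circlePoint_one t, (top t (abst t h)).1⟩
    have main' : ∀ z, ‖z‖ = 1 ∧ z ∈ frontier K →
        z ∈ frontier (Metric.closedBall (0 : Plane) 1) ∩ frontier K := by
      rintro z ⟨h1, h2⟩
      rw [frontier_closedBall _ one_ne_zero]
      exact ⟨by simpa using h1, h2⟩
    have neg : ∀ z, ‖-z‖ = 1 ∧ -z ∈ frontier K → ‖z‖ = 1 ∧ z ∈ frontier K := by
      rintro z ⟨h1, h2⟩
      exact ⟨by rwa [norm_neg] at h1, by simpa using hs.neg_mem_frontier h2⟩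
    rintro z (((h | h) | h) | h) <;> apply main'
    · exact main z (Or.inl h)
    · exact neg z (main _ (Or.inl h))
    · exact main z (Or.inr h)
    · exact neg z (main _ (Or.inr h))
  -- The bound θ < 1/2 puts the four arcs into disjoint regions defined by the thresholds ±1/2 for
  -- the coordinates.
  · have r : ∀ z ∈ openArc 1 (-θ) θ, 1 / 2 < z 0 ∧ |z 1| < 1 / 2 := by
      rintro z ⟨t, h, rfl⟩
      exact (right t (absr t (Set.Ioo_subset_Icc_self h))).2
    have t : ∀ z ∈ openArc 1 (Real.pi / 2 - θ) (Real.pi / 2 + θ), 1 / 2 < z 1 := by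
      rintro z ⟨t, h, rfl⟩
      exact (top t (abst t (Set.Ioo_subset_Icc_self h))).2
    have r' : ∀ z ∈ -openArc 1 (-θ) θ, 1 / 2 < -z 0 ∧ |z 1| < 1 / 2 := fun z hz => by
      simpa using r _ hz
    have t' : ∀ z ∈ -openArc 1 (Real.pi / 2 - θ) (Real.pi / 2 + θ), 1 / 2 < -z 1 := fun z hz => by
      simpa using t _ hz
    simp only [List.pairwise_cons, List.mem_cons, List.not_mem_nil, or_false, forall_eq_or_imp,
      forall_eq, List.Pairwise.nil, and_true, Set.disjoint_left, false_imp_iff, implies_true]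
    refine ⟨⟨fun z h h' => ?_, fun z h h' => ?_, fun z h h' => ?_⟩,
      ⟨fun z h h' => ?_, fun z h h' => ?_⟩, fun z h h' => ?_⟩
    · linarith [(r z h).1, (r' z h').1]
    · linarith [(abs_lt.1 (r z h).2).2, t z h']
    · linarith [(abs_lt.1 (r z h).2).1, t' z h']
    · linarith [(abs_lt.1 (r' z h).2).2, t z h']
    · linarith [(abs_lt.1 (r' z h).2).1, t' z h']
    · linarith [t z h, t' z h']
  · rintro _ ⟨t, h, rfl⟩
    refine ⟨_, ⟨t + Real.pi / 2, ⟨by linarith [h.1], by linarith [h.2]⟩, rfl⟩,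
      birkhoffOrthogonal_circlePoint ?_⟩
    rw [show t - (t + Real.pi / 2) = -(Real.pi / 2) by ring, Real.cos_neg, Real.cos_pi_div_two]
  · rintro _ ⟨t, h, rfl⟩
    refine ⟨_, ⟨t - Real.pi / 2, ⟨by linarith [h.1], by linarith [h.2]⟩, rfl⟩,
      birkhoffOrthogonal_circlePoint ?_⟩
    rw [sub_sub_cancel, Real.cos_pi_div_two]

/-- A normalized domain can be modified close to the coordinate axes so that it becomes an
Auerbach domain. -/
lemma exists_isADomain_near {K : Set Plane} (hK : IsSmoothSymmetricDomain K) (hN : IsNormalized K)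
    {η : ℝ} (h0 : 0 < η) (h1 : η < 1 / 2) :
    ∃ A, IsSmoothSymmetricDomain A ∧ IsNormalized A ∧ IsADomain A ∧
      ∀ z : Plane, η ≤ |z 0| → η ≤ |z 1| → (z ∈ K ↔ z ∈ A) := by
  obtain ⟨K', hK', hN', hag, θ, t0, t1, hθ⟩ := exists_arc_right hK hN h0 (by linarith)
  obtain ⟨A, hA, hNA, hag', ζ, z0, z1, hζ⟩ := exists_arc_top hK' hN' h0 (by linarith)
  refine ⟨A, hA, hNA, isADomain_of_arcs hA.domain hA.symm (lt_min t0 z0)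
    (by linarith [min_le_left θ ζ]) (fun y hy => ?_)
    (fun x hx => hζ x (hx.trans (min_le_right _ _))),
    fun z hz0 hz1 => (hag z hz1).trans (hag' z hz0)⟩
  have hy' := hy.trans (min_le_left _ _)
  -- The arc about e₁ survives the second modification, since its abscissas exceed η and only |x| <
  -- η was altered.
  have ev : ∀ᶠ z in nhds (!₂[√(1 - y ^ 2), y] : Plane), z ∈ K' ↔ z ∈ A := by
    have c : Continuous fun z : Plane => |z 0| := by fun_prop
    have hlt : η < |(!₂[√(1 - y ^ 2), y] : Plane) 0| := by
      have h2 : y ^ 2 ≤ θ ^ 2 :=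
        sq_le_sq' (by linarith [neg_abs_le y]) (by linarith [le_abs_self y])
      have : η < √(1 - y ^ 2) := Real.lt_sqrt_of_sq_lt (by nlinarith)
      simpa using this.trans_le (le_abs_self _)
    filter_upwards [(isOpen_lt continuous_const c).mem_nhds hlt] with z hz
    exact hag' z (le_of_lt hz)
  exact (mem_frontier_iff_of_eventually ev).1 (hθ y hy')

/-! ### Hausdorff distance -/

lemma norm_plane_le (z : Plane) : ‖z‖ ≤ |z 0| + |z 1| := by
  rw [EuclideanSpace.norm_eq, Fin.sum_univ_two]
  apply Real.sqrt_le_iff.2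
  simp only [Real.norm_eq_abs]
  exact ⟨by positivity, by nlinarith [abs_nonneg (z 0), abs_nonneg (z 1)]⟩

lemma mem_of_abs_add_abs_le {K : Set Plane} (hK : IsSmoothSymmetricDomain K)
    (hN : IsNormalized K) {z : Plane} (hz : |z 0| + |z 1| ≤ 1) : z ∈ K := by
  have hc := isCap_rightBoundary hK hN
  have h1 : |z 1| ≤ 1 := by linarith [abs_nonneg (z 0)]
  rw [eq_capRegion_rightBoundary hK hN]
  have a1 := hc.one_sub_abs_le h1
  have a2 := hc.one_sub_abs_le (y := -z 1) (by simpa using h1)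
  rw [abs_neg] at a2
  exact ⟨h1, by linarith [neg_abs_le (z 0)], by linarith [le_abs_self (z 0)]⟩

/-- Normalized domains that agree away from the coordinate axes are close to each other. -/
lemma exists_dist_le {K A : Set Plane} (hN : IsNormalized K) (hA : IsSmoothSymmetricDomain A)
    (hNA : IsNormalized A) {η : ℝ} (h0 : 0 < η)
    (h : ∀ z : Plane, η ≤ |z 0| → η ≤ |z 1| → (z ∈ K ↔ z ∈ A)) {z : Plane} (hz : z ∈ K) :
    ∃ w ∈ A, dist z w ≤ 2 * η := by
  by_cases hzA : z ∈ A
  · exact ⟨z, hzA, by simpa using h0.le⟩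
  have hsum : 1 < |z 0| + |z 1| := by
    by_contra hc
    exact hzA (mem_of_abs_add_abs_le hA hNA (not_lt.1 hc))
  obtain ⟨b0, b1⟩ := hN.abs_le z hz
  have key : ∀ w : Plane, dist z w ≤ |z 0 - w 0| + |z 1 - w 1| := fun w => by
    rw [dist_eq_norm]
    exact norm_plane_le (z - w)
  -- Outside the ℓ¹ ball but inside the square, |z 1| < η forces 1 - |z 0| < η, so `z` is within 2η
  -- of e₁ or -e₁; likewise with the axes exchanged.
  by_cases h1 : |z 1| < η
  · rcases le_total 0 (z 0) with hs | hs
    · refine ⟨_, hNA.right_mem, (key _).trans ?_⟩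
      rw [abs_of_nonneg hs] at hsum b0
      simp [abs_of_nonpos (show z 0 - 1 ≤ 0 by linarith)]
      linarith
    · refine ⟨_, hA.symm.neg_mem hNA.right_mem, (key _).trans ?_⟩
      rw [abs_of_nonpos hs] at hsum b0
      simp [abs_of_nonneg (show 0 ≤ z 0 + 1 by linarith)]
      linarith
  · have h2 : |z 0| < η := by
      by_contra h2
      exact hzA ((h z (not_lt.1 h2) (not_lt.1 h1)).1 hz)
    rcases le_total 0 (z 1) with hs | hs
    · refine ⟨_, hNA.top_mem, (key _).trans ?_⟩
      rw [abs_of_nonneg hs] at hsum b1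
      simp [abs_of_nonpos (show z 1 - 1 ≤ 0 by linarith)]
      linarith
    · refine ⟨_, hA.symm.neg_mem hNA.top_mem, (key _).trans ?_⟩
      rw [abs_of_nonpos hs] at hsum b1
      simp [abs_of_nonneg (show 0 ≤ z 1 + 1 by linarith)]
      linarith

/-! ### Normalization by a maximal determinant -/

lemma IsSmoothSymmetricDomain.zero_mem_interior {K : Set Plane} (hK : IsSmoothSymmetricDomain K) :
    (0 : Plane) ∈ interior K := by
  obtain ⟨q, hq⟩ := hK.domain.interior_nonempty
  by_cases h : q = 0
  · rwa [h] at hq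
  · have hne : q ≠ -q := fun e => h (plane_ext
      (show q 0 = 0 by linarith [show q 0 = -q 0 from congrArg (fun z : Plane => z 0) e])
      (show q 1 = 0 by linarith [show q 1 = -q 1 from congrArg (fun z : Plane => z 1) e]))
    have := hK.strict (interior_subset hq) (hK.symm.neg_mem (interior_subset hq)) hne
      (show (0 : ℝ) < 1 / 2 by norm_num) (show (0 : ℝ) < 1 / 2 by norm_num) (by norm_num)
    simpa using this

/-- Every domain has a linear image that is normalized: its coordinates are those with respect to
the vectors spanning a triangle with apex `0` of maximal area in the domain. -/
lemma exists_isNormalized_image {K : Set Plane} (hK : IsSmoothSymmetricDomain K) :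
    ∃ L : Plane ≃L[ℝ] Plane, IsNormalized (L '' K) := by
  let d : Plane × Plane → ℝ := fun w => |w.1 0 * w.2 1 - w.1 1 * w.2 0|
  have h0 := hK.zero_mem_interior
  obtain ⟨s, s0, hs⟩ := exists_add_smul_mem_of_mem_interior h0 !₂[1, 0]
  obtain ⟨t, t0, ht⟩ := exists_add_smul_mem_of_mem_interior h0 !₂[0, 1]
  obtain ⟨⟨u, v⟩, ⟨hu, hv⟩, hmax⟩ := (hK.domain.isCompact.prod hK.domain.isCompact).exists_isMaxOn
    ⟨(_, _), hs, ht⟩ (f := d) (by fun_prop)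
  set D := u 0 * v 1 - u 1 * v 0 with hD
  have hm : ∀ x ∈ K, ∀ y ∈ K, |x 0 * y 1 - x 1 * y 0| ≤ |D| := fun x hx y hy =>
    hmax (show (x, y) ∈ K ×ˢ K from ⟨hx, hy⟩)
  have D0 : D ≠ 0 := by
    intro h
    have := hm _ hs _ ht
    simp [h] at this
    exact this.not_gt (by positivity)
  -- Cramer's rule: the coordinates with respect to u, v are quotients of determinants by D, so
  -- maximality of |D| bounds them by 1 on `K`.
  let L : Plane ≃ₗ[ℝ] Plane :=
    { toFun := fun z => !₂[(z 0 * v 1 - z 1 * v 0) / D, (u 0 * z 1 - u 1 * z 0) / D]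
      invFun := fun w => w 0 • u + w 1 • v
      map_add' := fun x y => by
        apply plane_ext <;> simp <;> ring
      map_smul' := fun c x => by
        apply plane_ext <;> simp <;> ring
      left_inv := fun z => by
        apply plane_ext <;> simp <;> field_simp <;> rw [hD] <;> ring
      right_inv := fun w => by
        apply plane_ext <;> simp <;> field_simp <;> rw [hD] <;> ring }
  have L0 : ∀ z, L z 0 = (z 0 * v 1 - z 1 * v 0) / D := fun z => rfl
  have L1 : ∀ z, L z 1 = (u 0 * z 1 - u 1 * z 0) / D := fun z => rfl
  refine ⟨L.toContinuousLinearEquiv, ⟨u, hu, ?_⟩, ⟨v, hv, ?_⟩, ?_⟩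
  · apply plane_ext
    · exact (L0 u).trans (by simpa [hD] using div_self D0)
    · refine (L1 u).trans ?_
      simp [mul_comm]
  · apply plane_ext
    · refine (L0 v).trans ?_
      simp [mul_comm]
    · exact (L1 v).trans (by simpa [hD] using div_self D0)
  · rintro _ ⟨z, hz, rfl⟩
    show |L z 0| ≤ 1 ∧ |L z 1| ≤ 1
    rw [L0, L1, abs_div, abs_div, div_le_one (abs_pos.2 D0), div_le_one (abs_pos.2 D0)]
    exact ⟨hm z hz v hv, hm u hu z hz⟩

/-! ### Length of the boundary -/

lemma lipschitzWith_circlePoint_one : LipschitzWith 2 (circlePoint 1) := by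
  apply LipschitzWith.of_dist_le_mul
  intro s t
  have h1 := Real.lipschitzWith_cos.dist_le_mul s t
  have h2 := Real.lipschitzWith_sin.dist_le_mul s t
  simp only [Real.dist_eq, NNReal.coe_one, one_mul] at h1 h2
  rw [dist_eq_norm, Real.dist_eq]
  refine (norm_plane_le _).trans ?_
  simp only [circlePoint, one_mul]
  simp
  linarith

lemma exists_circlePoint_one_eq {z : Plane} (hz : ‖z‖ = 1) :
    ∃ t ∈ Set.Icc (-Real.pi) Real.pi, circlePoint 1 t = z := by
  set w : ℂ := ⟨z 0, z 1⟩ with hw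
  have hn : ‖w‖ = 1 := by
    rw [EuclideanSpace.norm_eq, Fin.sum_univ_two] at hz
    rw [← hz, Complex.norm_def, Complex.normSq_mk]
    simp [sq]
  refine ⟨w.arg, ⟨(Complex.neg_pi_lt_arg w).le, Complex.arg_le_pi w⟩, plane_ext ?_ ?_⟩
  · have := Complex.norm_mul_cos_arg w
    rw [hn] at this
    simpa [circlePoint] using this
  · have := Complex.norm_mul_sin_arg w
    rw [hn] at this
    simpa [circlePoint] using this

lemma hausdorffMeasure_sphere_lt_top : μH[1] (Metric.sphere (0 : Plane) 1) < ⊤ := by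
  have hsub : Metric.sphere (0 : Plane) 1 ⊆ circlePoint 1 '' Set.Icc (-Real.pi) Real.pi :=
    fun z hz => exists_circlePoint_one_eq (by simpa using hz)
  refine (MeasureTheory.measure_mono hsub).trans_lt
    ((lipschitzWith_circlePoint_one.hausdorffMeasure_image_le zero_le_one _).trans_lt ?_)
  rw [MeasureTheory.hausdorffMeasure_real, Real.volume_Icc]
  exact ENNReal.mul_lt_top (by simp) (by simp)

/-- The boundary of a bounded convex neighbourhood of the origin has finite length: it is the
image of a circle under the radial projection. -/
lemma hausdorffMeasure_frontier_lt_top {K : Set Plane} (hK : Convex ℝ K) (h0 : K ∈ nhds 0)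
    {R : ℝ} (hR : 0 < R) (hb : K ⊆ Metric.closedBall 0 R) : μH[1] (frontier K) < ⊤ := by
  obtain ⟨C, hC⟩ := hK.lipschitz_gauge h0
  have lower : ∀ z : Plane, ‖z‖ = 1 → R⁻¹ ≤ gauge K z := fun z hz => by
    have := le_gauge_of_subset_closedBall (absorbent_nhds_zero h0) hR.le hb (x := z)
    rwa [hz, one_div] at this
  have inv_le : ∀ z : Plane, ‖z‖ = 1 → (gauge K z)⁻¹ ≤ R := fun z hz =>
    inv_le_of_inv_le₀ hR (lower z hz)
  have pos : ∀ z : Plane, ‖z‖ = 1 → 0 < gauge K z := fun z hz =>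
    (inv_pos.2 hR).trans_le (lower z hz)
  set φ : Plane → Plane := fun z => (gauge K z)⁻¹ • z with hφ
  have hL : LipschitzOnWith (R + R * R * C).toNNReal φ (Metric.sphere 0 1) := by
    apply LipschitzOnWith.of_dist_le_mul
    intro x hx y hy
    rw [mem_sphere_zero_iff_norm] at hx hy
    have px := pos x hx
    have py := pos y hy
    -- This splits the change of φ into that of the point and that of the radial factor; the latter
    -- is controlled by the Lipschitz gauge and its lower bound on the sphere.
    have e : φ x - φ y = (gauge K x)⁻¹ • (x - y) +
        ((gauge K x)⁻¹ * (gauge K y)⁻¹ * (gauge K y - gauge K x)) • y := by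
      have : (gauge K x)⁻¹ * (gauge K y)⁻¹ * (gauge K y - gauge K x) =
          (gauge K x)⁻¹ - (gauge K y)⁻¹ := by field_simp
      rw [this, smul_sub, sub_smul]
      simp only [hφ]
      abel
    have hg : |gauge K y - gauge K x| ≤ C * ‖x - y‖ := by
      have := hC.dist_le_mul x y
      rwa [Real.dist_eq, dist_eq_norm, abs_sub_comm] at this
    rw [dist_eq_norm, dist_eq_norm, e, Real.coe_toNNReal _ (by positivity)]
    refine (norm_add_le _ _).trans ?_
    rw [norm_smul, norm_smul, hy, mul_one, norm_mul, norm_mul, Real.norm_eq_abs, Real.norm_eq_abs,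
      Real.norm_eq_abs, abs_of_pos (inv_pos.2 px), abs_of_pos (inv_pos.2 py), add_mul]
    have hi := inv_le x hx
    have hj := inv_le y hy
    have : (gauge K x)⁻¹ * (gauge K y)⁻¹ * |gauge K y - gauge K x| ≤ R * R * (C * ‖x - y‖) := by
      gcongr
    calc _ ≤ R * ‖x - y‖ + R * R * (C * ‖x - y‖) := by gcongr
      _ = _ := by ring
  have hsub : frontier K ⊆ φ '' Metric.sphere 0 1 := by
    intro z hz
    have hz1 := (gauge_eq_one_iff_mem_frontier hK h0).2 hz
    have hz0 : z ≠ 0 := by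
      rintro rfl
      simp at hz1
    have hn := norm_pos_iff.2 hz0
    refine ⟨‖z‖⁻¹ • z, by simp [norm_smul, hn.ne'], ?_⟩
    simp only [hφ]
    rw [gauge_smul_of_nonneg (inv_nonneg.2 hn.le), hz1, smul_eq_mul, mul_one, inv_inv, smul_smul,
      mul_inv_cancel₀ hn.ne', one_smul]
  refine (MeasureTheory.measure_mono hsub).trans_lt
    ((hL.hausdorffMeasure_image_le zero_le_one).trans_lt ?_)
  exact ENNReal.mul_lt_top (by simp) hausdorffMeasure_sphere_lt_top

/-- The part of the boundary of `K` in the `η`-neighbourhood of the coordinate axes. -/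
def frontierNearAxes (K : Set Plane) (η : ℝ) : Set Plane :=
  frontier K ∩ {z | |z 0| ≤ η ∨ |z 1| ≤ η}

lemma hausdorffMeasure_frontier_normalized_lt_top {K : Set Plane} (hK : IsSmoothSymmetricDomain K)
    (hN : IsNormalized K) : μH[1] (frontier K) < ⊤ :=
  hausdorffMeasure_frontier_lt_top hK.domain.convex
    (mem_interior_iff_mem_nhds.1 hK.zero_mem_interior) two_pos fun z hz => by
      have := hN.abs_le z hz
      rw [mem_closedBall_zero_iff]
      linarith [norm_plane_le z]

/-- Continuity from above, for which finite length is essential: a boundary point on an axis lies in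
the square but not inside the ℓ¹ ball, so the pieces intersect in at most four points. -/
lemma tendsto_hausdorffMeasure_frontierNearAxes {K : Set Plane} (hK : IsSmoothSymmetricDomain K)
    (hN : IsNormalized K) :
    Filter.Tendsto (fun n : ℕ => μH[1] (frontierNearAxes K (1 / ((n : ℝ) + 1)))) Filter.atTop
      (nhds 0) := by
  have closed : ∀ η, IsClosed (frontierNearAxes K η) := fun η =>
    isClosed_frontier.inter (IsClosed.union
      (isClosed_le (show Continuous fun z : Plane => |z 0| by fun_prop) continuous_const)
      (isClosed_le (show Continuous fun z : Plane => |z 1| by fun_prop) continuous_const))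
  have anti : Antitone fun n : ℕ => frontierNearAxes K (1 / ((n : ℝ) + 1)) := by
    intro m n hmn z hz
    have := Nat.one_div_le_one_div (α := ℝ) hmn
    exact ⟨hz.1, hz.2.imp (fun h => h.trans this) fun h => h.trans this⟩
  have lim := MeasureTheory.tendsto_measure_iInter_atTop (μ := (μH[1] : MeasureTheory.Measure Plane))
    (fun n : ℕ => (closed (1 / ((n : ℝ) + 1))).measurableSet.nullMeasurableSet) anti
    ⟨0, ((MeasureTheory.measure_mono Set.inter_subset_left).trans_lt
      (hausdorffMeasure_frontier_normalized_lt_top hK hN)).ne⟩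
  have hsub : (⋂ n : ℕ, frontierNearAxes K (1 / ((n : ℝ) + 1))) ⊆
      {!₂[1, 0], !₂[-1, 0], !₂[0, 1], !₂[0, -1]} := by
    intro z hz
    rw [Set.mem_iInter] at hz
    have hzf := (hz 0).1
    have hzK := hK.domain.isCompact.isClosed.frontier_subset hzf
    obtain ⟨b0, b1⟩ := hN.abs_le z hzK
    have hsum : 1 ≤ |z 0| + |z 1| := by
      by_contra h
      have c : Continuous fun z : Plane => |z 0| + |z 1| := by fun_prop
      refine hzf.2 (mem_interior_iff_mem_nhds.2 ?_)
      filter_upwards [(isOpen_lt c continuous_const).mem_nhds (not_le.1 h)] with w hw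
      exact mem_of_abs_add_abs_le hK hN (le_of_lt hw)
    have hmin : min |z 0| |z 1| ≤ 0 :=
      ge_of_tendsto' tendsto_one_div_add_atTop_nhds_zero_nat fun n => min_le_iff.2 (hz n).2
    rcases min_le_iff.1 hmin with h | h
    · have h0 : z 0 = 0 := abs_nonpos_iff.1 h
      have h1 : |z 1| = 1 := by
        rw [h0, abs_zero] at hsum
        linarith
      rcases eq_or_eq_neg_of_abs_eq h1 with h1 | h1
      · exact Or.inr (Or.inr (Or.inl (plane_ext (by simpa using h0) (by simpa using h1))))
      · exact Or.inr (Or.inr (Or.inr (plane_ext (by simpa using h0) (by simpa using h1))))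
    · have h0 : z 1 = 0 := abs_nonpos_iff.1 h
      have h1 : |z 0| = 1 := by
        rw [h0, abs_zero] at hsum
        linarith
      rcases eq_or_eq_neg_of_abs_eq h1 with h1 | h1
      · exact Or.inl (plane_ext (by simpa using h1) (by simpa using h0))
      · exact Or.inr (Or.inl (plane_ext (by simpa using h1) (by simpa using h0)))
  have := MeasureTheory.Measure.nullSingletonClass_hausdorff Plane (d := 1) one_pos
  rwa [MeasureTheory.measure_mono_null hsub (Set.Finite.measure_zero (Set.toFinite _) _)] at lim

/-! ### Approximation of an arbitrary domain -/

/-- The approximation theorem for a single domain. -/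
theorem exists_affineImage_near {K : Set Plane} (hK : IsSmoothSymmetricDomain K) {ε δ : ℝ}
    (hε : 0 < ε) (hδ : 0 < δ) :
    ∃ A', IsSmoothSymmetricDomain A' ∧ IsAffineImageOfADomain A' ∧
      Metric.hausdorffDist A' K < ε ∧
      planeLength (frontier K) <
        planeLength (frontier A' ∩ frontier K) + ENNReal.ofReal δ := by
  obtain ⟨L, hN⟩ := exists_isNormalized_image hK
  set N := L '' K with hNdef
  have hKN : K = L.symm '' N := (L.symm_image_image K).symm
  have hNs : IsSmoothSymmetricDomain N := hK.image L
  set T : Plane →L[ℝ] Plane := (L.symm : Plane →L[ℝ] Plane) with hT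
  have hTL : ∀ S : Set Plane, T '' S = L.symm '' S := fun S => rfl
  have hlip : ∀ S, μH[1] (T '' S) ≤ ‖T‖₊ * μH[1] S := fun S => by
    simpa using T.lipschitz.hausdorffMeasure_image_le zero_le_one S
  have u0 : Filter.Tendsto (fun n : ℕ => 1 / ((n : ℝ) + 1)) Filter.atTop (nhds 0) :=
    tendsto_one_div_add_atTop_nhds_zero_nat
  have e1 := u0.eventually_lt_const (show (0 : ℝ) < 1 / 2 by norm_num)
  have e2 : ∀ᶠ n : ℕ in Filter.atTop, ‖T‖ * (2 * (1 / ((n : ℝ) + 1))) < ε := by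
    have : Filter.Tendsto (fun n : ℕ => ‖T‖ * (2 * (1 / ((n : ℝ) + 1)))) Filter.atTop
      (nhds (‖T‖ * (2 * 0))) := (u0.const_mul 2).const_mul _
    rw [mul_zero, mul_zero] at this
    exact this.eventually_lt_const hε
  have e3 : ∀ᶠ n : ℕ in Filter.atTop,
      ‖T‖₊ * μH[1] (frontierNearAxes N (1 / ((n : ℝ) + 1))) < ENNReal.ofReal δ := by
    have := ENNReal.Tendsto.const_mul (a := (‖T‖₊ : ENNReal))
      (tendsto_hausdorffMeasure_frontierNearAxes hNs hN) (Or.inr (by simp))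
    rw [mul_zero] at this
    exact this.eventually_lt_const (by simpa using hδ)
  obtain ⟨n, h1, h2, h3⟩ := (e1.and (e2.and e3)).exists
  set η : ℝ := 1 / ((n : ℝ) + 1) with hη
  have h0 : 0 < η := by positivity
  obtain ⟨A, hA, hNA, hAD, hag⟩ := exists_isADomain_near hNs hN h0 h1
  have hdist : ∀ x y : Plane, dist x y ≤ 2 * η → dist (T x) (T y) ≤ ‖T‖ * (2 * η) :=
    fun x y h => (T.lipschitz.dist_le_mul x y).trans (by
      rw [coe_nnnorm]
      gcongr)
  refine ⟨L.symm '' A, hA.image L.symm, ⟨A, hAD, hA.smooth, hA.strict,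
    L.symm.toLinearEquiv.toAffineEquiv, rfl⟩, ?_, ?_⟩
  · refine (Metric.hausdorffDist_le_of_mem_dist (by positivity) ?_ ?_).trans_lt h2
    · rintro _ ⟨z, hz, rfl⟩
      obtain ⟨w, hw, hd⟩ := exists_dist_le hNA hNs hN h0 (fun z a b => (hag z a b).symm) hz
      exact ⟨L.symm w, hKN ▸ ⟨w, hw, rfl⟩, hdist z w hd⟩
    · intro y hy
      rw [hKN] at hy
      obtain ⟨z, hz, rfl⟩ := hy
      obtain ⟨w, hw, hd⟩ := exists_dist_le hN hA hNA h0 hag hz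
      exact ⟨L.symm w, ⟨w, hw, rfl⟩, hdist z w hd⟩
  · have hfK : frontier K = T '' frontier N := by
      rw [hTL, image_frontier_linear, ← hKN]
    have hsub : frontier K ⊆ (frontier (L.symm '' A) ∩ frontier K) ∪
        T '' frontierNearAxes N η := by
      intro y hy
      obtain ⟨z, hz, rfl⟩ := hfK ▸ hy
      by_cases hax : |z 0| ≤ η ∨ |z 1| ≤ η
      · exact Or.inr ⟨z, ⟨hz, hax⟩, rfl⟩
      · push Not at hax
        refine Or.inl ⟨?_, hy⟩
        rw [← image_frontier_linear]
        refine ⟨z, (mem_frontier_iff_of_eventually ?_).1 hz, rfl⟩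
        have c0 : Continuous fun z : Plane => |z 0| := by fun_prop
        have c1 : Continuous fun z : Plane => |z 1| := by fun_prop
        filter_upwards [(isOpen_lt continuous_const c0).mem_nhds hax.1,
          (isOpen_lt continuous_const c1).mem_nhds hax.2] with w a b
        exact hag w (le_of_lt a) (le_of_lt b)
    have hfin : μH[1] (frontier K) < ⊤ := by
      rw [hfK]
      exact (hlip _).trans_lt (ENNReal.mul_lt_top (by simp)
        (hausdorffMeasure_frontier_normalized_lt_top hNs hN))
    unfold planeLength
    refine ((MeasureTheory.measure_mono hsub).trans (MeasureTheory.measure_union_le _ _)).trans_lt ?_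
    -- Adding a common term preserves strict inequality only if that term is finite, hence `hfin`.
    exact ENNReal.add_lt_add_left
      ((MeasureTheory.measure_mono Set.inter_subset_right).trans_lt hfin).ne
      ((hlip _).trans_lt h3)

lemma mem_smoothSymmetricDomains {K : NonemptyCompacts Plane} :
    K ∈ smoothSymmetricDomains ↔ IsSmoothSymmetricDomain (K : Set Plane) :=
  ⟨fun ⟨a, b, c, d⟩ => ⟨a, b, c, d⟩, fun ⟨a, b, c, d⟩ => ⟨a, b, c, d⟩⟩

theorem mainTheorem4 :
    Dense {A' : smoothSymmetricDomains |
      IsAffineImageOfADomain ((A' : NonemptyCompacts Plane) : Set Plane)} ∧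
    ∀ K ∈ smoothSymmetricDomains, ∀ ε > (0 : ℝ), ∀ δ > (0 : ℝ),
      ∃ A' ∈ smoothSymmetricDomains,
        IsAffineImageOfADomain (A' : Set Plane) ∧
        dist A' K < ε ∧
        planeLength (frontier (K : Set Plane)) <
          planeLength (frontier (A' : Set Plane) ∩ frontier (K : Set Plane)) +
            ENNReal.ofReal δ := by
  have main : ∀ K ∈ smoothSymmetricDomains, ∀ ε > (0 : ℝ), ∀ δ > (0 : ℝ),
      ∃ A' ∈ smoothSymmetricDomains,
        IsAffineImageOfADomain (A' : Set Plane) ∧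
        dist A' K < ε ∧
        planeLength (frontier (K : Set Plane)) <
          planeLength (frontier (A' : Set Plane) ∩ frontier (K : Set Plane)) +
            ENNReal.ofReal δ := by
    intro K hK ε hε δ hδ
    obtain ⟨A, hA, hAD, hd, hl⟩ := exists_affineImage_near (mem_smoothSymmetricDomains.1 hK) hε hδ
    exact ⟨⟨⟨A, hA.domain.isCompact⟩, 0, interior_subset hA.zero_mem_interior⟩,
      mem_smoothSymmetricDomains.2 hA, hAD, hd, hl⟩
  refine ⟨Metric.dense_iff.2 fun K ε hε => ?_, main⟩
  obtain ⟨A', hA, hAD, hd, -⟩ := main K K.2 ε hε 1 one_pos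
  exact ⟨⟨A', hA⟩, hd, hAD⟩
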